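/- Let $\lambda=(\lambda_1\ge\dots\ge\lambda_h>0)$ be a partition (possibly empty, with $\lambda_1=0$ then). For $n\ge|\lambda|+\lambda_1$ put $\lambda[n]=(n-|\lambda|,\lambda_1,\dots,\lambda_h)$ and let $S^\lambda_n$ be the complex Specht module of $\lambda[n]$, i.e. the span of the vectors $v_T=\sum_{\sigma\in C(T)}\operatorname{sgn}(\sigma)\{\sigma T\}$ in the space spanned by the tabloids of shape $\lambda[n]$, where $T$ runs over the bijective fillings of the diagram of $\lambda[n]$ by $[n]=\{1,\dots,n\}$ and $C(T)$ is the column stabilizer; put $S^\lambda_n=0$ for $n<|\lambda|+\lambda_1$. An injection $f:[m]\hookrightarrow[n]$ induces $f_*:S^\lambda_m\to S^\lambda_n$ (apply $f$ to the entries of a tabloid and put the elements of $[n]\setminus f([m])$ into the first row); this is the FI-module $S^\lambda_\bullet$. For $n\ge|\lambda|+\lambda_1$ the intrinsic arrangement $\mathcal A_{\lambda[n]}$ in $S^\lambda_n$ consists of the subspaces $$H_\alpha=\sum_{\tau\in T_\alpha}(S^\lambda_n)^\tau ,$$ where $\alpha$ runs over the set partitions of $[n]$ whose part sizes form the conjugate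 partition $\lambda[n]^\dagger$, $T_\alpha$ is a set of transpositions generating $\mathfrak S_\alpha=\prod_i\mathfrak S_{\alpha_i}$, and $(S^\lambda_n)^\tau$ is the fixed space of $\tau$. For smaller $n$ the arrangement is empty. For an arrangement $\mathcal A$ let $\mathcal L(\mathcal A)$ be the set of all intersections of its hyperplanes, including the whole space. An FI-arrangement is a functor from FI (the sets $[n]$, $n\ge0$, with injections) to finite central complex hyperplane arrangements, where a morphism $(V,\mathcal A)\to(W,\mathcal B)$ is a linear surjection $\varphi:W\to V$ such that $\varphi^{-1}(H)\in\mathcal B$ for every $H\in\mathcal A$. Then: 1. $H_\alpha$ does not depend on the choice of $T_\alpha$. 2. For every $n$ there is an $\mathfrak S_n$-equivariant isomorphism $S^\lambda_n\cong(S^\lambda_n)^\vee$. 3. For every choice of such isomorphisms, one for each $n$, let $f^*:S^\lambda_n\to S^\lambda_m$ be the map that corresponds under them to the transpose $(f_*)^\vee:(S^\lambda_n)^\vee\to(S^\lambda_m)^\vee$, for each injection $f:[m]\hookrightarrow[n]$. Then the pairs $(S^\lambda_n,\mathcal A_{\lambda[n]})$ with the maps $f^*$ form an FI-arrangement (in particular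 every $H_\alpha$ is a hyperplane). This FI-arrangement is * finitely generated: there is $N$ such that for all $n\ge N$ every $S\in\mathcal L(\mathcal A_{\lambda[n]})$ is an intersection of subspaces $(f^*)^{-1}(U)$ with $f:[N]\hookrightarrow[n]$ and $U\in\mathcal L(\mathcal A_{\lambda[N]})$; * normal: for every injection $f:[m]\hookrightarrow[n]$, every $S\in\mathcal L(\mathcal A_{\lambda[n]})$ with $\ker f^*\subseteq S$ equals $(f^*)^{-1}(U)$ for some $U\in\mathcal L(\mathcal A_{\lambda[m]})$. -/

import Mathlib

noncomputable section

namespace SpechtArr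

/-! ### Padded partitions (partitions are identified with their Young diagrams) -/

/-- The padded partition `lam[n] = (n - |lam|, lam_1, lam_2, …)`, for `n ≥ |lam| + lam_1`. -/
def padded (lam : YoungDiagram) (n : ℕ) (h : lam.card + lam.rowLen 0 ≤ n) : YoungDiagram where
  cells := ((Finset.range (n - lam.card)).image fun j => ((0 : ℕ), j)) ∪
    lam.cells.image fun c => (c.1 + 1, c.2)
  isLowerSet := by
    rintro ⟨i, j⟩ ⟨i', j'⟩ hle hmem
    obtain ⟨hi, hj⟩ := Prod.mk_le_mk.1 hle
    simp only [Finset.coe_union, Finset.coe_image, Set.mem_union, Set.mem_image, Finset.mem_coe,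
      Finset.mem_range, Prod.mk.injEq, Prod.exists, YoungDiagram.mem_cells] at hmem ⊢
    rcases hmem with ⟨k, hk, h0, rfl⟩ | ⟨a, b, hab, rfl, rfl⟩
    · exact Or.inl ⟨j', by omega, by omega, rfl⟩
    · rcases i' with _ | i'
      · left
        have h1 : (0, b) ∈ lam := lam.up_left_mem (Nat.zero_le _) le_rfl hab
        have h2 := YoungDiagram.mem_iff_lt_rowLen.1 h1
        exact ⟨j', by omega, rfl, rfl⟩
      · exact Or.inr ⟨i', j', lam.up_left_mem (by omega) hj hab, rfl, rfl⟩

theorem mem_padded {lam : YoungDiagram} {n : ℕ} {h : lam.card + lam.rowLen 0 ≤ n} {c : ℕ × ℕ} :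
    c ∈ (padded lam n h).cells ↔
      (c.1 = 0 ∧ c.2 < n - lam.card) ∨ ∃ i, c.1 = i + 1 ∧ (i, c.2) ∈ lam.cells := by
  obtain ⟨i, j⟩ := c
  simp only [padded, Finset.mem_union, Finset.mem_image, Finset.mem_range, Prod.mk.injEq,
    Prod.exists]
  constructor
  · rintro (⟨k, hk, h0, rfl⟩ | ⟨a, b, hab, rfl, rfl⟩)
    · exact Or.inl ⟨h0.symm, hk⟩
    · exact Or.inr ⟨a, rfl, hab⟩
  · rintro (⟨h0, hk⟩ | ⟨a, ha, hab⟩)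
    · exact Or.inl ⟨j, hk, h0.symm, rfl⟩
    · exact Or.inr ⟨a, j, hab, ha.symm, rfl⟩

theorem card_padded (lam : YoungDiagram) (n : ℕ) (h : lam.card + lam.rowLen 0 ≤ n) :
    (padded lam n h).cells.card = n := by
  have hd : Disjoint ((Finset.range (n - lam.card)).image fun j => ((0 : ℕ), j))
      (lam.cells.image fun c => (c.1 + 1, c.2)) := by
    rw [Finset.disjoint_left]
    rintro ⟨i, j⟩ h1 h2
    simp only [Finset.mem_image, Prod.mk.injEq] at h1 h2
    obtain ⟨_, _, h1, _⟩ := h1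
    obtain ⟨_, _, h2, _⟩ := h2
    omega
  show (_ ∪ _ : Finset (ℕ × ℕ)).card = n
  rw [Finset.card_union_of_disjoint hd, Finset.card_image_of_injective,
    Finset.card_image_of_injective, Finset.card_range]
  · change n - lam.card + lam.card = n
    omega
  · rintro ⟨a, b⟩ ⟨c, d⟩ hh
    simpa using hh
  · intro a b hh
    simpa using hh

/-! ### Specht modules -/

/-- The free complex vector space on all functions `r : [n] → ℕ`.  A tabloid `{T}` is recorded by
the function sending each `a ∈ [n]` to the row of `T` that contains `a` (two tableaux of the same
shape are row equivalent iff they have the same row function), so this space contains every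
permutation module `M^μ`, `μ` a partition of `n`, as the span of the tabloids of shape `μ`. -/
abbrev RowSpace (n : ℕ) : Type := (Fin n → ℕ) →₀ ℂ

/-- The row function of a tableau `T`, i.e. its tabloid `{T}`. -/
def tabloid {μ : YoungDiagram} {n : ℕ} (T : μ.cells ≃ Fin n) : Fin n → ℕ :=
  fun a => (T.symm a).1.1

/-- The permutations of `[n]` that preserve the columns of the tableau `T`. -/
def columnStabilizer {μ : YoungDiagram} {n : ℕ} (T : μ.cells ≃ Fin n) :
    Finset (Equiv.Perm (Fin n)) :=
  Finset.univ.filter fun σ => ∀ a, (T.symm (σ a)).1.2 = (T.symm a).1.2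

/-- `v_T = ∑_{σ ∈ C(T)} sgn(σ) {σ T}`, where `σ T` has the entry `σ a` where `T` has `a`. -/
def polytabloid {μ : YoungDiagram} {n : ℕ} (T : μ.cells ≃ Fin n) : RowSpace n :=
  ∑ σ ∈ columnStabilizer T,
    Finsupp.single (tabloid (T.trans σ)) (((Equiv.Perm.sign σ : ℤˣ) : ℤ) : ℂ)

/-- The Specht module `S^μ`, spanned by the vectors `v_T`, `T` a tableau of shape `μ`. -/
def specht (μ : YoungDiagram) (n : ℕ) : Submodule ℂ (RowSpace n) :=
  Submodule.span ℂ (Set.range fun T : μ.cells ≃ Fin n => polytabloid T)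

/-- `S^lam_n`: the Specht module of `lam[n]` if `n ≥ |lam| + lam_1`, and `0` otherwise. -/
def paddedSpecht (lam : YoungDiagram) (n : ℕ) : Submodule ℂ (RowSpace n) :=
  if h : lam.card + lam.rowLen 0 ≤ n then specht (padded lam n h) n else ⊥

/-! ### The FI-module `n ↦ S^lam_n` -/

/-- The map induced by an injection `f : [m] → [n]` on row functions: `f` is applied to the
entries, and the elements of `[n]` outside the image of `f` are put into the first row. -/
def rowMap {m n : ℕ} (f : Fin m ↪ Fin n) : RowSpace m →ₗ[ℂ] RowSpace n :=
  Finsupp.lmapDomain ℂ ℂ fun r => Function.extend f r fun _ => 0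

theorem rowMap_single {m n : ℕ} (f : Fin m ↪ Fin n) (r : Fin m → ℕ) (c : ℂ) :
    rowMap f (Finsupp.single r c) = Finsupp.single (Function.extend f r fun _ => 0) c := by
  simp [rowMap, Finsupp.lmapDomain_apply, Finsupp.mapDomain_single]

theorem rowMap_refl (n : ℕ) : rowMap (Function.Embedding.refl (Fin n)) = LinearMap.id := by
  ext1 r
  ext1
  simp only [LinearMap.comp_apply, Finsupp.lsingle_apply, rowMap_single, LinearMap.id_apply]
  congr 1
  funext a
  exact (Function.Embedding.refl (Fin n)).injective.extend_apply r _ a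

theorem rowMap_trans {l m n : ℕ} (f : Fin l ↪ Fin m) (g : Fin m ↪ Fin n) :
    rowMap (f.trans g) = rowMap g ∘ₗ rowMap f := by
  ext1 r
  ext1
  simp only [LinearMap.comp_apply, Finsupp.lsingle_apply, rowMap_single]
  congr 1
  funext b
  by_cases hb : ∃ a, g a = b
  · obtain ⟨a, rfl⟩ := hb
    rw [g.injective.extend_apply]
    by_cases ha : ∃ c, f c = a
    · obtain ⟨c, rfl⟩ := ha
      rw [f.injective.extend_apply]
      exact (f.trans g).injective.extend_apply r _ c
    · rw [Function.extend_apply' _ _ _ ha, Function.extend_apply']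
      rintro ⟨c, hc⟩
      exact ha ⟨c, g.injective hc⟩
  · rw [Function.extend_apply' _ _ _ hb, Function.extend_apply']
    rintro ⟨c, hc⟩
    exact hb ⟨f c, hc⟩

/-- Extending a tableau of shape `lam[m]` along `f` to one of shape `lam[n]`, the new entries
being placed at the end of the first row. -/
theorem exists_extend_tableau {lam : YoungDiagram} {m n : ℕ} (f : Fin m ↪ Fin n)
    (hm : lam.card + lam.rowLen 0 ≤ m) (hn : lam.card + lam.rowLen 0 ≤ n)
    (T : (padded lam m hm).cells ≃ Fin m) :
    ∃ T' : (padded lam n hn).cells ≃ Fin n, (∀ a, (T'.symm (f a)).1 = (T.symm a).1) ∧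
      ∀ b, (¬ ∃ a, f a = b) → (T'.symm b).1.1 = 0 ∧ m - lam.card ≤ (T'.symm b).1.2 := by
  have hmn : m ≤ n := by simpa using Fintype.card_le_of_embedding f
  have hsub : ∀ c, c ∈ (padded lam m hm).cells → c ∈ (padded lam n hn).cells := by
    intro c hc
    rw [mem_padded] at hc ⊢
    rcases hc with ⟨h1, h2⟩ | hc
    · exact Or.inl ⟨h1, by omega⟩
    · exact Or.inr hc
  let s : Finset (Fin n) := Finset.univ.map f
  let F : Fin n → ℕ × ℕ := fun b => if hb : ∃ a, f a = b then (T.symm hb.choose).1 else (0, 0)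
  have hF : ∀ a, F (f a) = (T.symm a).1 := by
    intro a
    have hb : ∃ a', f a' = f a := ⟨a, rfl⟩
    have : hb.choose = a := f.injective hb.choose_spec
    simp only [F, dif_pos hb, this]
  obtain ⟨g, hg⟩ := Finset.exists_equiv_extend_of_card_eq (α := Fin n)
    (t := (padded lam n hn).cells) (by rw [card_padded, Fintype.card_fin]) (s := s) (f := F)
    (by
      intro c hc
      obtain ⟨b, hb, rfl⟩ := Finset.mem_image.1 hc
      obtain ⟨a, -, rfl⟩ := Finset.mem_map.1 hb
      rw [hF]
      exact hsub _ (T.symm a).2)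
    (by
      intro b hb b' hb' h
      obtain ⟨a, -, rfl⟩ := Finset.mem_map.1 hb
      obtain ⟨a', -, rfl⟩ := Finset.mem_map.1 hb'
      rw [hF, hF] at h
      rw [T.symm.injective (Subtype.ext h)])
  have hgf : ∀ a, (g (f a)).1 = (T.symm a).1 := fun a => by
    rw [hg (f a) (Finset.mem_map_of_mem f (Finset.mem_univ a)), hF]
  refine ⟨g.symm, fun a => by simpa using hgf a, fun b hb => ?_⟩
  have hnot : (g b).1 ∉ (padded lam m hm).cells := by
    intro hc
    apply hb
    refine ⟨T ⟨_, hc⟩, g.injective (Subtype.ext ?_)⟩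
    rw [hgf]
    simp
  have hin := (g b).2
  rw [mem_padded] at hnot hin
  simp only [Equiv.symm_symm]
  rcases hin with ⟨h1, h2⟩ | hin
  · refine ⟨h1, ?_⟩
    by_contra hlt
    exact hnot (Or.inl ⟨h1, by omega⟩)
  · exact absurd (Or.inr hin) hnot

/-- `f_* v_T = v_{T'}`, where `T'` extends `f ∘ T` along the first row. -/
theorem rowMap_polytabloid {lam : YoungDiagram} {m n : ℕ} (f : Fin m ↪ Fin n)
    (hm : lam.card + lam.rowLen 0 ≤ m) (hn : lam.card + lam.rowLen 0 ≤ n)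
    (T : (padded lam m hm).cells ≃ Fin m) :
    ∃ T' : (padded lam n hn).cells ≃ Fin n, rowMap f (polytabloid T) = polytabloid T' := by
  obtain ⟨T', h1, h2⟩ := exists_extend_tableau f hm hn T
  refine ⟨T', ?_⟩
  have hvia : ∀ (σ : Equiv.Perm (Fin m)) a,
      σ.viaFintypeEmbedding f (f a) = f (σ a) := fun σ a =>
    Equiv.Perm.viaFintypeEmbedding_apply_image σ f a
  have hvia' : ∀ (σ : Equiv.Perm (Fin m)) b, (¬ ∃ a, f a = b) →
      σ.viaFintypeEmbedding f b = b := fun σ b hb =>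
    Equiv.Perm.viaFintypeEmbedding_apply_notMem_range σ f hb
  -- elements outside the image of `f` are alone in their column
  have alone : ∀ b, (¬ ∃ a, f a = b) → ∀ b', (T'.symm b').1.2 = (T'.symm b).1.2 → b' = b := by
    intro b hb b' hbb
    obtain ⟨hr, hc⟩ := h2 b hb
    have hmem := (T'.symm b').2
    rw [mem_padded] at hmem
    rcases hmem with ⟨h0, -⟩ | ⟨i, -, hi⟩
    · exact T'.symm.injective (Subtype.ext (Prod.ext (h0.trans hr.symm) hbb))
    · exfalso
      have h3 : (0, (T'.symm b').1.2) ∈ lam := lam.up_left_mem (Nat.zero_le _) le_rfl hi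
      have h4 := YoungDiagram.mem_iff_lt_rowLen.1 h3
      omega
  unfold polytabloid
  rw [map_sum]
  refine Finset.sum_bij (fun σ _ => σ.viaFintypeEmbedding f) ?_ ?_ ?_ ?_
  · intro σ hσ
    simp only [columnStabilizer, Finset.mem_filter, Finset.mem_univ, true_and] at hσ ⊢
    intro b
    by_cases hb : ∃ a, f a = b
    · obtain ⟨a, rfl⟩ := hb
      rw [hvia, h1, h1, hσ]
    · rw [hvia' σ b hb]
  · intro σ _ τ _ h
    ext1 a
    have := congrArg (fun p : Equiv.Perm (Fin n) => p (f a)) h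
    simp only [hvia] at this
    exact f.injective this
  · intro σ' hσ'
    simp only [columnStabilizer, Finset.mem_filter, Finset.mem_univ, true_and] at hσ'
    have hfix : ∀ b, (¬ ∃ a, f a = b) → σ' b = b := fun b hb => alone b hb _ (hσ' b)
    have hpres : ∀ a, ∃ a', f a' = σ' (f a) := by
      intro a
      by_contra hna
      have h3 := hfix _ hna
      have h4 : σ' (f a) = f a := σ'.injective h3
      exact hna ⟨a, h4.symm⟩
    choose s hs using hpres
    have hinj : Function.Injective s := by
      intro a a' haa
      apply f.injective
      apply σ'.injective
      rw [← hs, ← hs, haa]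
    let σ : Equiv.Perm (Fin m) := Equiv.ofBijective s (Finite.injective_iff_bijective.1 hinj)
    have hσ : ∀ a, f (σ a) = σ' (f a) := hs
    refine ⟨σ, ?_, ?_⟩
    · simp only [columnStabilizer, Finset.mem_filter, Finset.mem_univ, true_and]
      intro a
      rw [← h1, ← h1, hσ, hσ']
    · ext1 b
      by_cases hb : ∃ a, f a = b
      · obtain ⟨a, rfl⟩ := hb
        rw [hvia, hσ]
      · rw [hvia' σ b hb, hfix b hb]
  · intro σ _
    rw [rowMap_single, Equiv.Perm.viaFintypeEmbedding_sign]
    congr 1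
    funext b
    by_cases hb : ∃ a, f a = b
    · obtain ⟨a, rfl⟩ := hb
      rw [f.injective.extend_apply]
      simp only [tabloid, Equiv.symm_trans_apply]
      have : (σ.viaFintypeEmbedding f).symm (f a) = f (σ.symm a) := by
        rw [Equiv.symm_apply_eq, hvia, Equiv.apply_symm_apply]
      rw [this, h1]
    · rw [Function.extend_apply' _ _ _ hb]
      simp only [tabloid, Equiv.symm_trans_apply]
      have : (σ.viaFintypeEmbedding f).symm b = b := by
        rw [Equiv.symm_apply_eq, hvia' σ b hb]
      rw [this, (h2 b hb).1]

theorem rowMap_mem {lam : YoungDiagram} {m n : ℕ} (f : Fin m ↪ Fin n) :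
    ∀ x ∈ paddedSpecht lam m, rowMap f x ∈ paddedSpecht lam n := by
  have hmn : m ≤ n := by simpa using Fintype.card_le_of_embedding f
  intro x hx
  by_cases hm : lam.card + lam.rowLen 0 ≤ m
  · have hn : lam.card + lam.rowLen 0 ≤ n := hm.trans hmn
    rw [paddedSpecht, dif_pos hm] at hx
    rw [paddedSpecht, dif_pos hn]
    have hle : specht (padded lam m hm) m ≤
        (specht (padded lam n hn) n).comap (rowMap f) := by
      rw [specht, Submodule.span_le]
      rintro _ ⟨T, rfl⟩
      obtain ⟨T', hT'⟩ := rowMap_polytabloid f hm hn T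
      exact Submodule.subset_span ⟨T', hT'.symm⟩
    exact hle hx
  · rw [paddedSpecht, dif_neg hm, Submodule.mem_bot] at hx
    rw [hx, map_zero]
    exact Submodule.zero_mem _

/-- The structure map `f_* : S^lam_m → S^lam_n` of the FI-module `S^lam_•`. -/
def spechtMap (lam : YoungDiagram) {m n : ℕ} (f : Fin m ↪ Fin n) :
    paddedSpecht lam m →ₗ[ℂ] paddedSpecht lam n :=
  (rowMap f).restrict (rowMap_mem f)

theorem spechtMap_refl (lam : YoungDiagram) (n : ℕ) :
    spechtMap lam (Function.Embedding.refl (Fin n)) = LinearMap.id := by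
  ext1 x
  exact Subtype.ext (by rw [spechtMap, LinearMap.coe_restrict_apply, rowMap_refl]; rfl)

theorem spechtMap_trans (lam : YoungDiagram) {l m n : ℕ} (f : Fin l ↪ Fin m)
    (g : Fin m ↪ Fin n) :
    spechtMap lam (f.trans g) = spechtMap lam g ∘ₗ spechtMap lam f := by
  ext1 x
  exact Subtype.ext (by rw [spechtMap, LinearMap.coe_restrict_apply, rowMap_trans]; rfl)

/-- The representation of the symmetric group on `S^lam_n`: a permutation `σ` sends the tabloid
`{T}` to `{σ T}`. -/
def spechtRep (lam : YoungDiagram) (n : ℕ) :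
    Representation ℂ (Equiv.Perm (Fin n)) (paddedSpecht lam n) where
  toFun σ := spechtMap lam σ.toEmbedding
  map_one' := spechtMap_refl lam n
  map_mul' σ τ := spechtMap_trans lam τ.toEmbedding σ.toEmbedding

/-! ### Intrinsic arrangements -/

/-- The set partition `α` of `[n]` has shape `μ`: its part sizes are the row lengths of `μ`. -/
def HasShape {n : ℕ} (α : Finpartition (Finset.univ : Finset (Fin n))) (μ : YoungDiagram) : Prop :=
  α.parts.val.map Finset.card = (μ.rowLens : Multiset ℕ)

/-- The subgroup `𝔖_α = ∏ 𝔖_{α_i}` of permutations preserving every part of `α`. -/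
def partSubgroup {n : ℕ} (α : Finpartition (Finset.univ : Finset (Fin n))) :
    Subgroup (Equiv.Perm (Fin n)) where
  carrier := {σ | ∀ a, α.part (σ a) = α.part a}
  mul_mem' := by
    intro σ τ hσ hτ a
    rw [Equiv.Perm.mul_apply, hσ, hτ]
  one_mem' := fun _ => rfl
  inv_mem' := by
    intro σ hσ a
    rw [← hσ (σ⁻¹ a)]
    simp

/-- `∑_{τ ∈ T} V^τ`, the sum of the fixed spaces of the elements of `T`. -/
def sumFixed {n : ℕ} {V : Type*} [AddCommMonoid V] [Module ℂ V]
    (ρ : Representation ℂ (Equiv.Perm (Fin n)) V) (T : Set (Equiv.Perm (Fin n))) :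
    Submodule ℂ V :=
  ⨆ τ ∈ T, LinearMap.eqLocus (ρ τ) LinearMap.id

/-- `H_α = ∑_{τ ∈ T_α} V^τ`, with `T_α` the set of all transpositions in `𝔖_α`. -/
def intrinsicHyperplane {n : ℕ} {V : Type*} [AddCommMonoid V] [Module ℂ V]
    (ρ : Representation ℂ (Equiv.Perm (Fin n)) V)
    (α : Finpartition (Finset.univ : Finset (Fin n))) : Submodule ℂ V :=
  sumFixed ρ {τ | τ.IsSwap ∧ τ ∈ partSubgroup α}

/-- The intrinsic arrangement `{H_α | α a set partition of [n] whose shape is conjugate to lam[n]}`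
in `S^lam_n` for `n ≥ |lam| + lam_1`; no hyperplanes (in the zero space) for smaller `n`. -/
def intrinsicArrangement (lam : YoungDiagram) (n : ℕ) :
    Set (Submodule ℂ (paddedSpecht lam n)) :=
  {H | ∃ (h : lam.card + lam.rowLen 0 ≤ n) (α : Finpartition (Finset.univ : Finset (Fin n))),
    HasShape α (padded lam n h).transpose ∧
    H = intrinsicHyperplane (spechtRep lam n) α}

/-! ### FI-arrangements -/

/-- The lattice of flats: all intersections of hyperplanes of the arrangement (the whole space
is the empty intersection). -/
def flats {V : Type*} [AddCommGroup V] [Module ℂ V] (A : Set (Submodule ℂ V)) :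
    Set (Submodule ℂ V) :=
  {S | ∃ B ⊆ A, S = sInf B}

section FIArrangement

variable {V : ℕ → Type*} [∀ n, AddCommGroup (V n)] [∀ n, Module ℂ (V n)]

/-- `(V_•, A_•)` with the maps `φ f : V_n → V_m` induced by the injections `f : [m] → [n]` is an
FI-arrangement, i.e. a functor from FI to finite central complex hyperplane arrangements, where a
morphism `(V, A) → (W, B)` is a linear surjection `W → V` that pulls hyperplanes of `A` back to
hyperplanes of `B`. -/
structure IsFIArrangement (A : ∀ n, Set (Submodule ℂ (V n)))
    (φ : ∀ m n, (Fin m ↪ Fin n) → (V n →ₗ[ℂ] V m)) : Prop where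
  finiteDimensional : ∀ n, FiniteDimensional ℂ (V n)
  finite : ∀ n, (A n).Finite
  isHyperplane : ∀ n, ∀ H ∈ A n, Module.finrank ℂ (V n ⧸ H) = 1
  map_refl : ∀ n, φ n n (Function.Embedding.refl (Fin n)) = LinearMap.id
  map_trans : ∀ (l m n : ℕ) (f : Fin l ↪ Fin m) (g : Fin m ↪ Fin n),
    φ l n (f.trans g) = φ l m f ∘ₗ φ m n g
  surjective : ∀ (m n : ℕ) (f : Fin m ↪ Fin n), Function.Surjective (φ m n f)
  comap_mem : ∀ (m n : ℕ) (f : Fin m ↪ Fin n), ∀ H ∈ A m, H.comap (φ m n f) ∈ A n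

/-- Finite generation: for some `N` and all `n ≥ N`, every flat of `A_n` is an intersection of
preimages of flats of `A_N`. -/
def IsFinitelyGenerated (A : ∀ n, Set (Submodule ℂ (V n)))
    (φ : ∀ m n, (Fin m ↪ Fin n) → (V n →ₗ[ℂ] V m)) : Prop :=
  ∃ N, ∀ n, N ≤ n → ∀ S ∈ flats (A n),
    ∃ C ⊆ {W | ∃ (f : Fin N ↪ Fin n), ∃ U ∈ flats (A N), W = U.comap (φ N n f)}, S = sInf C

/-- Normality: every flat of `A_n` containing the kernel of the map induced by `f : [m] → [n]` is
the preimage of a flat of `A_m`. -/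
def IsNormal (A : ∀ n, Set (Submodule ℂ (V n)))
    (φ : ∀ m n, (Fin m ↪ Fin n) → (V n →ₗ[ℂ] V m)) : Prop :=
  ∀ (m n : ℕ) (f : Fin m ↪ Fin n), ∀ S ∈ flats (A n), LinearMap.ker (φ m n f) ≤ S →
    ∃ U ∈ flats (A m), S = U.comap (φ m n f)

end FIArrangement

/-! ### The dual FI-module, transported to `S^lam_•` along self-duality -/

/-- A linear isomorphism `S^lam_n ≃ (S^lam_n)^∨` is equivariant for the symmetric group. -/
def IsSelfDuality (lam : YoungDiagram) (n : ℕ)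
    (e : paddedSpecht lam n ≃ₗ[ℂ] Module.Dual ℂ (paddedSpecht lam n)) : Prop :=
  ∀ σ x, e (spechtRep lam n σ x) = (spechtRep lam n).dual σ (e x)

/-- The map `f^* : S^lam_n → S^lam_m` obtained from the dual (transpose) of
`f_* : S^lam_m → S^lam_n` through identifications `e n : S^lam_n ≃ (S^lam_n)^∨`. -/
def dualSpechtMap (lam : YoungDiagram)
    (e : ∀ n, paddedSpecht lam n ≃ₗ[ℂ] Module.Dual ℂ (paddedSpecht lam n))
    (m n : ℕ) (f : Fin m ↪ Fin n) : paddedSpecht lam n →ₗ[ℂ] paddedSpecht lam m :=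
  (e m).symm.toLinearMap ∘ₗ (spechtMap lam f).dualMap ∘ₗ (e n).toLinearMap

end SpechtArr

end

noncomputable section

namespace SpechtArr

/-! ### The symmetric group action on row functions -/

/-! Fix an equivariant identification `e` of V = S^λ_n with its dual and write w^⊥ for the set of x
with e x w = 0. For a transposition τ, the space V^τ consists of the vectors y + τy (up to a factor
2), so w pairs to zero with V^τ exactly when τw = -w. Hence w pairs to zero with all of H_α iff
every transposition in 𝔖_α negates w. If the parts of α are the columns of T, such w form the line
through v_T (`eq_smul_polytabloid`), so H_α = v_T^⊥ (`intrinsicHyperplane_eq_orthogonal`). The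
arrangement is thus the set of all v_T^⊥, whichever `e` is chosen.

One-dimensionality of that line: if two entries of a column of T share a row of S, swapping them
fixes {S} and forces its coefficient in w to vanish. Otherwise {S} = {σT} with σ in C(T), by a
counting argument (`exists_mem_columnStabilizer_tabloid_eq`). So w is determined by its coefficient
at {T}.

Since f^* is adjoint to f_*, it is surjective because f_* is injective, and (f^*)^{-1}(w^⊥) = (f_*
w)^⊥. As f_* sends polytabloids to polytabloids, hyperplanes pull back to hyperplanes. Finite
generation and normality both rest on one criterion: v_T is a nonzero multiple of some f_* v_{T₀}
iff the entries of T missed by f lie beyond the first λ_1 columns. Those columns hold |λ| + λ_1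
entries, which gives N; and ker f^* ⊆ v_T^⊥ says precisely that v_T lies in the image of f_*. -/

theorem rowMap_injective {m n : ℕ} (f : Fin m ↪ Fin n) : Function.Injective (rowMap f) :=
  Finsupp.mapDomain_injective (Function.extend_injective f.injective _)

theorem rowMap_apply_extend {m n : ℕ} (f : Fin m ↪ Fin n) (x : RowSpace m) (r : Fin m → ℕ) :
    rowMap f x (Function.extend f r fun _ => 0) = x r :=
  Finsupp.mapDomain_apply (Function.extend_injective f.injective _) x r

theorem rowMap_perm_apply {n : ℕ} (σ : Equiv.Perm (Fin n)) (x : RowSpace n) (r : Fin n → ℕ) :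
    rowMap σ.toEmbedding x r = x (r ∘ σ) := by
  rw [← rowMap_apply_extend σ.toEmbedding x (r ∘ σ)]
  congr 1
  funext a
  obtain ⟨b, rfl⟩ := σ.surjective a
  exact (σ.injective.extend_apply (r ∘ σ) (fun _ => 0) b).symm

theorem rowMap_apply_eq_zero {m n : ℕ} (f : Fin m ↪ Fin n) (x : RowSpace m) {r : Fin n → ℕ}
    {b : Fin n} (hb : ¬ ∃ a, f a = b) (hr : r b ≠ 0) : rowMap f x r = 0 := by
  refine Finsupp.mapDomain_of_notMem_range x r ?_
  rintro ⟨s, rfl⟩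
  exact hr (Function.extend_apply' _ _ _ hb)

theorem coe_spechtRep {lam : YoungDiagram} {n : ℕ} (σ : Equiv.Perm (Fin n))
    (x : paddedSpecht lam n) : (spechtRep lam n σ x : RowSpace n) = rowMap σ.toEmbedding x := rfl

theorem spechtMap_injective (lam : YoungDiagram) {m n : ℕ} (f : Fin m ↪ Fin n) :
    Function.Injective (spechtMap lam f) := fun _ _ h =>
  Subtype.ext (rowMap_injective f (congrArg Subtype.val h))

/-! ### Permutations preserving a colouring -/

/-- A permutation lies in a group generated by transpositions as soon as it preserves the orbits;
here the transposition of a and σ a preserves colours and joins the two points. -/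
theorem mem_closure_swaps_of_comp_eq {n : ℕ} {β : Type*} (c : Fin n → β)
    (σ : Equiv.Perm (Fin n)) (hσ : ∀ a, c (σ a) = c a) :
    σ ∈ Subgroup.closure {τ : Equiv.Perm (Fin n) | τ.IsSwap ∧ ∀ a, c (τ a) = c a} := by
  set S := {τ : Equiv.Perm (Fin n) | τ.IsSwap ∧ ∀ a, c (τ a) = c a} with hS
  rw [mem_closure_isSwap fun τ hτ => hτ.1]
  refine ⟨Set.toFinite _, fun a => ?_⟩
  by_cases ha : σ a = a
  · rw [ha]
    exact MulAction.mem_orbit_self a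
  · refine ⟨⟨Equiv.swap a (σ a), Subgroup.subset_closure ⟨⟨a, σ a, Ne.symm ha, rfl⟩, ?_⟩⟩, ?_⟩
    · intro b
      rw [Equiv.swap_apply_def]
      split_ifs with h1 h2
      · rw [h1, hσ]
      · rw [h2, hσ]
      · rfl
    · exact Equiv.swap_apply_left a (σ a)

/-! ### Polytabloids -/

section Polytabloid

variable {μ : YoungDiagram} {n : ℕ} (T : μ.cells ≃ Fin n)

theorem mem_columnStabilizer {σ : Equiv.Perm (Fin n)} :
    σ ∈ columnStabilizer T ↔ ∀ a, (T.symm (σ a)).1.2 = (T.symm a).1.2 := by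
  simp [columnStabilizer]

theorem mul_mem_columnStabilizer {σ τ : Equiv.Perm (Fin n)} (hσ : σ ∈ columnStabilizer T)
    (hτ : τ ∈ columnStabilizer T) : σ * τ ∈ columnStabilizer T := by
  rw [mem_columnStabilizer] at *
  intro a
  rw [Equiv.Perm.mul_apply, hσ, hτ]

theorem inv_mem_columnStabilizer {σ : Equiv.Perm (Fin n)} (hσ : σ ∈ columnStabilizer T) :
    σ⁻¹ ∈ columnStabilizer T := by
  rw [mem_columnStabilizer] at *
  intro a
  rw [← hσ (σ⁻¹ a)]
  simp

theorem swap_mem_columnStabilizer {a b : Fin n} (h : (T.symm a).1.2 = (T.symm b).1.2) :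
    Equiv.swap a b ∈ columnStabilizer T := by
  rw [mem_columnStabilizer]
  intro c
  rw [Equiv.swap_apply_def]
  split_ifs with h1 h2
  · rw [h1, h]
  · rw [h2, h]
  · rfl

theorem tabloid_trans (σ : Equiv.Perm (Fin n)) : tabloid (T.trans σ) = tabloid T ∘ ⇑σ⁻¹ := rfl

/-- Row and column determine a cell, and C(T) fixes the columns. So no cancellation occurs among the
terms of v_T. -/
theorem eq_of_tabloid_trans_eq {σ τ : Equiv.Perm (Fin n)} (hσ : σ ∈ columnStabilizer T)
    (hτ : τ ∈ columnStabilizer T) (h : tabloid (T.trans σ) = tabloid (T.trans τ)) : σ = τ := by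
  have hσ' := (mem_columnStabilizer T).1 (inv_mem_columnStabilizer T hσ)
  have hτ' := (mem_columnStabilizer T).1 (inv_mem_columnStabilizer T hτ)
  refine inv_injective (Equiv.ext fun a => T.symm.injective (Subtype.ext (Prod.ext ?_ ?_)))
  · exact congrFun h a
  · rw [hσ', hτ']

theorem polytabloid_apply_tabloid {τ : Equiv.Perm (Fin n)} (hτ : τ ∈ columnStabilizer T) :
    polytabloid T (tabloid (T.trans τ)) = ((Equiv.Perm.sign τ : ℤˣ) : ℤ) := by
  rw [polytabloid, Finsupp.finsetSum_apply, Finset.sum_eq_single τ]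
  · simp
  · intro σ hσ hne
    rw [Finsupp.single_apply, if_neg]
    exact fun h => hne (eq_of_tabloid_trans_eq T hσ hτ h)
  · exact fun h => absurd hτ h

theorem polytabloid_apply_self : polytabloid T (tabloid T) = 1 := by
  have h := polytabloid_apply_tabloid T (τ := 1) (by simp [mem_columnStabilizer])
  simpa [tabloid_trans] using h

theorem polytabloid_ne_zero : polytabloid T ≠ 0 := fun h => by
  simpa [h] using polytabloid_apply_self T

theorem rowMap_perm_polytabloid {τ : Equiv.Perm (Fin n)} (hτ : τ ∈ columnStabilizer T) :
    rowMap τ.toEmbedding (polytabloid T) =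
      (((Equiv.Perm.sign τ : ℤˣ) : ℤ) : ℂ) • polytabloid T := by
  have hsq : (((Equiv.Perm.sign τ : ℤˣ) : ℤ) : ℂ) * (((Equiv.Perm.sign τ : ℤˣ) : ℤ) : ℂ) = 1 := by
    rcases Int.units_eq_one_or (Equiv.Perm.sign τ) with h | h <;> simp [h]
  unfold polytabloid
  rw [map_sum, Finset.smul_sum]
  refine Finset.sum_bij (fun σ _ => τ * σ) (fun σ hσ => mul_mem_columnStabilizer T hτ hσ)
    (fun σ _ ρ _ h => mul_left_cancel h)
    (fun σ hσ => ⟨τ⁻¹ * σ, mul_mem_columnStabilizer T (inv_mem_columnStabilizer T hτ) hσ, by simp⟩)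
    fun σ hσ => ?_
  rw [rowMap_single, Finsupp.smul_single, smul_eq_mul, map_mul]
  push_cast
  rw [← mul_assoc, hsq, one_mul]
  congr 1
  funext a
  obtain ⟨b, rfl⟩ := τ.surjective a
  refine (τ.injective.extend_apply (tabloid (T.trans σ)) (fun _ => 0) b).trans ?_
  simp [tabloid_trans]

/-- If the entries of each column of `T` lie in distinct rows of `S`, then `{S} = {σ T}` for some
`σ` in the column stabilizer of `T`. -/
theorem exists_mem_columnStabilizer_tabloid_eq (S : μ.cells ≃ Fin n)
    (h : ∀ a b, (T.symm a).1.2 = (T.symm b).1.2 → tabloid S a = tabloid S b → a = b) :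
    ∃ σ ∈ columnStabilizer T, tabloid S = tabloid (T.trans σ) := by
  let col : Fin n → ℕ := fun a => (T.symm a).1.2
  have hmemT : ∀ a, tabloid T a < μ.colLen (col a) := fun a =>
    YoungDiagram.mem_iff_lt_colLen.1 (T.symm a).2
  -- the entries of column `j` that lie in the first `k` rows of `T`
  have hcardT : ∀ j k, (Finset.univ.filter fun a => tabloid T a < k ∧ col a = j).card =
      min (μ.colLen j) k := by
    intro j k
    rw [← Finset.card_range (min (μ.colLen j) k)]
    refine Finset.card_bij (fun a _ => tabloid T a) ?_ ?_ ?_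
    · intro a ha
      simp only [Finset.mem_filter, Finset.mem_univ, true_and, Finset.mem_range] at ha ⊢
      have := hmemT a
      rw [ha.2] at this
      omega
    · intro a ha b hb hab
      simp only [Finset.mem_filter, Finset.mem_univ, true_and] at ha hb
      exact T.symm.injective (Subtype.ext (Prod.ext hab (ha.2.trans hb.2.symm)))
    · intro i hi
      rw [Finset.mem_range] at hi
      have hc : (i, j) ∈ μ.cells := YoungDiagram.mem_iff_lt_colLen.2 (by omega)
      refine ⟨T ⟨(i, j), hc⟩, ?_, by simp [tabloid]⟩
      rw [Finset.mem_filter]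
      simp only [Finset.mem_univ, true_and, col, tabloid, Equiv.symm_apply_apply, and_true]
      omega
  -- The entries of column j of T lie in distinct rows of S, so at most k of them lie in its first k
  -- rows.
  have hcardS : ∀ j k, (Finset.univ.filter fun a => tabloid S a < k ∧ col a = j).card ≤
      (Finset.univ.filter fun a => tabloid T a < k ∧ col a = j).card := by
    intro j k
    have hinj : Set.InjOn (tabloid S)
        (Finset.univ.filter fun a => tabloid S a < k ∧ col a = j : Finset (Fin n)) := by
      intro a ha b hb hab
      simp only [Finset.coe_filter, Finset.mem_univ, true_and, Set.mem_ofPred_eq] at ha hb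
      exact h a b (ha.2.trans hb.2.symm) hab
    rw [hcardT, le_min_iff]
    constructor
    · calc _ ≤ (Finset.univ.filter fun a => tabloid T a < μ.colLen j ∧ col a = j).card := by
            refine Finset.card_le_card fun a ha => ?_
            simp only [Finset.mem_filter, Finset.mem_univ, true_and] at ha ⊢
            exact ⟨ha.2 ▸ hmemT a, ha.2⟩
        _ = _ := by rw [hcardT, min_self]
    · rw [← Finset.card_image_of_injOn hinj]
      refine (Finset.card_le_card (t := Finset.range k) fun i hi => ?_).trans_eq
        (Finset.card_range k)
      obtain ⟨a, ha, rfl⟩ := Finset.mem_image.1 hi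
      simp only [Finset.mem_filter, Finset.mem_univ, true_and] at ha
      exact Finset.mem_range.2 ha.1
  have htot : ∀ k, (Finset.univ.filter fun a => tabloid S a < k).card =
      (Finset.univ.filter fun a => tabloid T a < k).card := by
    intro k
    refine Finset.card_equiv (S.symm.trans T) fun a => ?_
    rw [Finset.mem_filter, Finset.mem_filter]
    simp [tabloid]
  have hsum : ∀ (U : Fin n → ℕ) k, (Finset.univ.filter fun a => U a < k).card =
      ∑ j ∈ Finset.univ.image col, (Finset.univ.filter fun a => U a < k ∧ col a = j).card := by
    intro U k
    rw [Finset.card_eq_sum_card_fiberwise (f := col) (t := Finset.univ.image col)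
      fun a _ => Finset.mem_coe.2 (Finset.mem_image_of_mem _ (Finset.mem_univ a))]
    simp only [Finset.filter_filter]
  -- Summed over all columns the two counts agree, since S and T have the same shape; the columnwise
  -- inequalities are therefore equalities.
  have heq : ∀ a k, (Finset.univ.filter fun b => tabloid S b < k ∧ col b = col a).card =
      min (μ.colLen (col a)) k := by
    intro a k
    rw [← hcardT]
    refine (Finset.sum_eq_sum_iff_of_le (s := Finset.univ.image col)
      fun j _ => hcardS j k).1 ?_ (col a) (Finset.mem_image_of_mem _ (Finset.mem_univ a))
    rw [← hsum, ← hsum, htot]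
  -- Taking k to be the length of the column of a shows that the whole column lies in the first k
  -- rows of S.
  have hlt : ∀ a, (tabloid S a, col a) ∈ μ.cells := by
    intro a
    have h1 : (Finset.univ.filter fun b => tabloid S b < μ.colLen (col a) ∧ col b = col a) =
        Finset.univ.filter fun b => tabloid T b < μ.colLen (col a) ∧ col b = col a := by
      have hsub : (Finset.univ.filter fun b => tabloid S b < μ.colLen (col a) ∧ col b = col a) ⊆
          Finset.univ.filter fun b => tabloid T b < μ.colLen (col a) ∧ col b = col a := by
        intro b hb
        simp only [Finset.mem_filter, Finset.mem_univ, true_and] at hb ⊢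
        exact ⟨hb.2 ▸ hmemT b, hb.2⟩
      exact Finset.eq_of_subset_of_card_le hsub (by rw [heq, hcardT])
    have h2 : a ∈ Finset.univ.filter fun b => tabloid T b < μ.colLen (col a) ∧ col b = col a := by
      simp [hmemT]
    rw [← h1, Finset.mem_filter] at h2
    exact YoungDiagram.mem_iff_lt_colLen.2 h2.2.1
  -- This sends a to the entry of T in the row that a has in S and the column that a has in T. It
  -- satisfies {S} = {T} ∘ s, so the required permutation is its inverse.
  let s : Fin n → Fin n := fun a => T ⟨_, hlt a⟩
  have hs : Function.Injective s := by
    intro a b hab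
    have h1 : (tabloid S a, col a) = (tabloid S b, col b) := congrArg Subtype.val (T.injective hab)
    exact h a b (Prod.mk.inj h1).2 (Prod.mk.inj h1).1
  let σ : Equiv.Perm (Fin n) := Equiv.ofBijective s (Finite.injective_iff_bijective.1 hs)
  have hσ : σ ∈ columnStabilizer T := by
    rw [mem_columnStabilizer]
    intro a
    change (T.symm (T ⟨_, hlt a⟩)).1.2 = _
    simp [col]
  refine ⟨σ⁻¹, inv_mem_columnStabilizer T hσ, ?_⟩
  rw [tabloid_trans, inv_inv]
  funext a
  change _ = (T.symm (T ⟨_, hlt a⟩)).1.1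
  simp

theorem exists_tabloid_of_mem_specht {x : RowSpace n} (hx : x ∈ specht μ n) {r : Fin n → ℕ}
    (hr : x r ≠ 0) : ∃ S : μ.cells ≃ Fin n, r = tabloid S := by
  by_contra hno
  have hle : specht μ n ≤ LinearMap.ker (Finsupp.lapply r : RowSpace n →ₗ[ℂ] ℂ) := by
    rw [specht, Submodule.span_le]
    rintro _ ⟨S, rfl⟩
    simp only [SetLike.mem_coe, LinearMap.mem_ker, Finsupp.lapply_apply, polytabloid,
      Finsupp.finsetSum_apply]
    refine Finset.sum_eq_zero fun σ _ => Finsupp.single_eq_of_ne ?_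
    exact fun h => hno ⟨_, h⟩
  exact hr (hle hx)

/-- A vector of the Specht module on which the transpositions of the column stabilizer of `T` act
by `-1` is a multiple of `v_T`. -/
theorem eq_smul_polytabloid {x : RowSpace n} (hx : x ∈ specht μ n)
    (hswap : ∀ τ ∈ columnStabilizer T, τ.IsSwap → rowMap τ.toEmbedding x = -x) :
    x = x (tabloid T) • polytabloid T := by
  have hsgn : ∀ y : RowSpace n,
      (∀ τ ∈ columnStabilizer T, τ.IsSwap → rowMap τ.toEmbedding y = -y) →
      ∀ σ ∈ columnStabilizer T, ∀ r : Fin n → ℕ,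
        y (r ∘ σ) = (((Equiv.Perm.sign σ : ℤˣ) : ℤ) : ℂ) * y r := by
    intro y hy σ hσ
    have hcl := mem_closure_swaps_of_comp_eq (fun a => (T.symm a).1.2) σ
      ((mem_columnStabilizer T).1 hσ)
    clear hσ
    induction hcl using Subgroup.closure_induction with
    | mem τ hτ =>
      intro r
      rw [← rowMap_perm_apply, hy τ ((mem_columnStabilizer T).2 hτ.2) hτ.1, hτ.1.sign_eq]
      simp
    | one => simp
    | mul σ τ _ _ hσ hτ =>
      intro r
      rw [Equiv.Perm.coe_mul, ← Function.comp_assoc, hτ, hσ, map_mul]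
      push_cast
      ring
    | inv σ _ hσ =>
      intro r
      have h := hσ (r ∘ ⇑σ⁻¹)
      have h2 : (r ∘ ⇑σ⁻¹) ∘ ⇑σ = r := by
        funext a
        simp
      rw [h2] at h
      rw [h, Equiv.Perm.sign_inv, ← mul_assoc]
      rcases Int.units_eq_one_or (Equiv.Perm.sign σ) with h | h <;> simp [h]
  -- After subtracting the multiple of v_T that matches the coefficient at {T}, it remains to show
  -- that a sign-vector with coefficient 0 at {T} vanishes.
  set y := x - x (tabloid T) • polytabloid T with hy
  suffices h0 : y = 0 from sub_eq_zero.1 h0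
  have hymem : y ∈ specht μ n :=
    Submodule.sub_mem _ hx (Submodule.smul_mem _ _ (Submodule.subset_span ⟨T, rfl⟩))
  have hyswap : ∀ τ ∈ columnStabilizer T, τ.IsSwap → rowMap τ.toEmbedding y = -y := by
    intro τ hτ hsw
    rw [hy, map_sub, map_smul, hswap τ hτ hsw, rowMap_perm_polytabloid T hτ, hsw.sign_eq]
    simp
    abel
  have hyT : y (tabloid T) = 0 := by
    simp [hy, polytabloid_apply_self]
  ext r
  by_contra hr
  obtain ⟨S, rfl⟩ := exists_tabloid_of_mem_specht hymem hr
  apply hr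
  by_cases hd : ∀ a b, (T.symm a).1.2 = (T.symm b).1.2 → tabloid S a = tabloid S b → a = b
  · obtain ⟨σ, hσ, hS⟩ := exists_mem_columnStabilizer_tabloid_eq T S hd
    rw [hS, tabloid_trans, hsgn y hyswap _ (inv_mem_columnStabilizer T hσ), hyT, mul_zero]
    rfl
  · push Not at hd
    obtain ⟨a, b, hcol, hrow, hne⟩ := hd
    have hτ := swap_mem_columnStabilizer T hcol
    have h := hsgn y hyswap _ hτ (tabloid S)
    have h2 : tabloid S ∘ ⇑(Equiv.swap a b) = tabloid S := by
      funext c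
      rw [Function.comp_apply, Equiv.swap_apply_def]
      split_ifs with h1 h2
      · rw [h1, hrow]
      · rw [h2, hrow]
      · rfl
    rw [h2, Equiv.Perm.sign_swap hne] at h
    push_cast at h
    rw [neg_one_mul] at h
    exact self_eq_neg.1 h

end Polytabloid

/-! ### Tableaux and set partitions -/

theorem card_fiber_eq {A C : Type*} [DecidableEq C] (s : Finset A) (f : A → C) (c : C) :
    Fintype.card {x : s // f x.1 = c} = (s.val.filter fun a => c = f a).card := by
  rw [Fintype.card_subtype, ← Finset.card_map (Function.Embedding.subtype _)]
  change _ = (s.filter fun a => c = f a).card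
  congr 1
  ext a
  simp [eq_comm, and_comm]

/-- Equal multisets of values have fibres of equal size, and bijections of the fibres glue. -/
theorem exists_equiv_of_map_eq {A B C : Type*} [DecidableEq C] {s : Finset A} {t : Finset B}
    {f : A → C} {g : B → C} (h : s.val.map f = t.val.map g) :
    ∃ e : s ≃ t, ∀ x, g (e x).1 = f x.1 := by
  have hcard : ∀ c, Fintype.card {x : s // f x.1 = c} = Fintype.card {y : t // g y.1 = c} := by
    intro c
    have h1 := congrArg (Multiset.count c) h
    rw [Multiset.count_map, Multiset.count_map] at h1
    rw [card_fiber_eq, card_fiber_eq, h1]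
  refine ⟨Equiv.ofFiberEquiv (f := fun x : s => f x.1) (g := fun y : t => g y.1)
    fun c => Fintype.equivOfCardEq (hcard c), fun x => ?_⟩
  exact Equiv.ofFiberEquiv_map (g := fun y : t => g y.1) _ x

/-- The parts of `α` are the columns of `T`. -/
def IsColumnPartition {μ : YoungDiagram} {n : ℕ} (T : μ.cells ≃ Fin n)
    (α : Finpartition (Finset.univ : Finset (Fin n))) : Prop :=
  ∀ a b, α.part a = α.part b ↔ (T.symm a).1.2 = (T.symm b).1.2

theorem rowLens_transpose (μ : YoungDiagram) :
    (μ.transpose.rowLens : Multiset ℕ) = (Finset.range (μ.rowLen 0)).val.map μ.colLen := by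
  simp only [YoungDiagram.rowLens, YoungDiagram.colLen_transpose, ← Multiset.map_coe,
    Finset.range_val]
  exact Multiset.map_congr rfl fun j _ => μ.rowLen_transpose j

theorem exists_tableau_of_hasShape {μ : YoungDiagram} {n : ℕ}
    {α : Finpartition (Finset.univ : Finset (Fin n))} (hα : HasShape α μ.transpose) :
    ∃ T : μ.cells ≃ Fin n, IsColumnPartition T α := by
  rw [HasShape, rowLens_transpose] at hα
  -- Equality of shapes matches the parts of α with the columns of μ of the same size; filling each
  -- column with its part gives T.
  obtain ⟨e, he⟩ := exists_equiv_of_map_eq hα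
  let part : Fin n → α.parts := fun a => ⟨α.part a, α.part_mem.2 (Finset.mem_univ a)⟩
  let col : Fin n → ℕ := fun a => (e (part a)).1
  have hcol : ∀ j, Fintype.card {c : μ.cells // c.1.2 = j} = Fintype.card {a // col a = j} := by
    intro j
    have h1 : Fintype.card {c : μ.cells // c.1.2 = j} = μ.colLen j := by
      rw [Fintype.card_subtype, ← Finset.card_map (Function.Embedding.subtype _),
        YoungDiagram.colLen_eq_card]
      congr 1
      ext c
      rw [YoungDiagram.mem_col_iff, Finset.mem_map]
      constructor
      · rintro ⟨d, hd, rfl⟩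
        exact ⟨d.2, (Finset.mem_filter.1 hd).2⟩
      · rintro ⟨h, h'⟩
        exact ⟨⟨c, h⟩, Finset.mem_filter.2 ⟨Finset.mem_univ _, h'⟩, rfl⟩
    rw [h1, Fintype.card_subtype]
    by_cases hj : j ∈ Finset.range (μ.rowLen 0)
    · have h2 := he (e.symm ⟨j, hj⟩)
      rw [Equiv.apply_symm_apply] at h2
      refine h2.trans (congrArg Finset.card ?_)
      ext a
      rw [Finset.mem_filter, ← α.part_eq_iff_mem (e.symm ⟨j, hj⟩).2]
      simp only [Finset.mem_univ, true_and, col]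
      rw [← Subtype.ext_iff (a1 := part a), Equiv.eq_symm_apply, Subtype.ext_iff]
    · have h2 : μ.colLen j = 0 := by
        by_contra h0
        exact hj (Finset.mem_range.2 (YoungDiagram.mem_iff_lt_rowLen.1
          (YoungDiagram.mem_iff_lt_colLen.2 (Nat.pos_of_ne_zero h0))))
      rw [h2, eq_comm, Finset.card_eq_zero, Finset.filter_eq_empty_iff]
      rintro a - rfl
      exact hj (e (part a)).2
  let T : μ.cells ≃ Fin n := Equiv.ofFiberEquiv (f := fun c : μ.cells => c.1.2) (g := col)
    fun j => Fintype.equivOfCardEq (hcol j)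
  have hT : ∀ a, (T.symm a).1.2 = col a := by
    intro a
    rw [← Equiv.ofFiberEquiv_map (f := fun c : μ.cells => c.1.2) (g := col)
      (fun j => Fintype.equivOfCardEq (hcol j)) (T.symm a)]
    change col (T (T.symm a)) = col a
    rw [Equiv.apply_symm_apply]
  refine ⟨T, fun a b => ?_⟩
  rw [hT, hT]
  simp only [col]
  rw [← Subtype.ext_iff, e.apply_eq_iff_eq, Subtype.ext_iff]

theorem exists_isColumnPartition {μ : YoungDiagram} {n : ℕ} (T : μ.cells ≃ Fin n) :
    ∃ α : Finpartition (Finset.univ : Finset (Fin n)),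
      HasShape α μ.transpose ∧ IsColumnPartition T α := by
  classical
  let col : Fin n → ℕ := fun a => (T.symm a).1.2
  let α := Finpartition.ofSetoid (Setoid.ker col)
  have hmem : ∀ a b, b ∈ α.part a ↔ col a = col b := fun a b =>
    Finpartition.mem_part_ofSetoid_iff_rel
  have hpart : IsColumnPartition T α := by
    intro a b
    rw [← α.mem_part_iff_part_eq_part (Finset.mem_univ a) (Finset.mem_univ b), hmem, eq_comm]
  refine ⟨α, ?_, hpart⟩
  let F : ℕ → Finset (Fin n) := fun j => Finset.univ.filter fun a => col a = j
  have hex : ∀ i j, i < μ.colLen j → ∃ a, T.symm a = (i, j) := by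
    intro i j h
    exact ⟨T ⟨(i, j), YoungDiagram.mem_iff_lt_colLen.2 h⟩, by simp⟩
  have hcard : ∀ j, (F j).card = μ.colLen j := by
    intro j
    rw [YoungDiagram.colLen_eq_card]
    refine Finset.card_bij (fun a _ => (T.symm a).1) ?_ ?_ ?_
    · intro a ha
      rw [YoungDiagram.mem_col_iff]
      exact ⟨(T.symm a).2, (Finset.mem_filter.1 ha).2⟩
    · intro a _ b _ h
      exact T.symm.injective (Subtype.ext h)
    · intro c hc
      rw [YoungDiagram.mem_col_iff] at hc
      refine ⟨T ⟨c, hc.1⟩, ?_, by simp⟩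
      rw [Finset.mem_filter]
      simpa [col] using hc.2
  have hpos : ∀ j, j < μ.rowLen 0 → 0 < μ.colLen j := fun j hj =>
    YoungDiagram.mem_iff_lt_colLen.1 (YoungDiagram.mem_iff_lt_rowLen.2 hj)
  have hFpart : ∀ a, α.part a = F (col a) := by
    intro a
    ext b
    rw [hmem, Finset.mem_filter, eq_comm]
    simp
  have hparts : α.parts = (Finset.range (μ.rowLen 0)).image F := by
    ext p
    rw [Finset.mem_image]
    constructor
    · intro hp
      obtain ⟨a, -, rfl⟩ := α.part_surjOn hp
      refine ⟨col a, Finset.mem_range.2 ?_, (hFpart a).symm⟩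
      have h0 := μ.up_left_mem (Nat.zero_le _) le_rfl (T.symm a).2
      exact YoungDiagram.mem_iff_lt_rowLen.1 h0
    · rintro ⟨j, hj, rfl⟩
      obtain ⟨a, ha⟩ := hex 0 j (hpos j (Finset.mem_range.1 hj))
      have : col a = j := congrArg Prod.snd ha
      rw [← this, ← hFpart]
      exact α.part_mem.2 (Finset.mem_univ a)
  -- Every column with index below `μ.rowLen 0` is nonempty, so distinct columns give distinct parts
  -- and multiplicities are preserved.
  have hinj : Set.InjOn F (Finset.range (μ.rowLen 0) : Finset ℕ) := by
    intro i hi j hj h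
    obtain ⟨a, ha⟩ := hex 0 i (hpos i (Finset.mem_range.1 hi))
    have hai : col a = i := congrArg Prod.snd ha
    have : a ∈ F i := Finset.mem_filter.2 ⟨Finset.mem_univ a, hai⟩
    rw [h] at this
    exact hai.symm.trans (Finset.mem_filter.1 this).2
  rw [HasShape, rowLens_transpose, hparts, Finset.image_val_of_injOn hinj, Multiset.map_map]
  exact Multiset.map_congr rfl fun j _ => hcard j

/-! ### Sums of fixed spaces -/

/-- For a transposition τ in T the vector τx + x is fixed by τ. So T acts by -1 on the quotient by
the sum of fixed spaces, and the group it generates acts there by the sign. -/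
theorem apply_sub_sign_smul_mem_sumFixed {n : ℕ} {V : Type*} [AddCommGroup V] [Module ℂ V]
    (ρ : Representation ℂ (Equiv.Perm (Fin n)) V) {T : Set (Equiv.Perm (Fin n))}
    (hT : ∀ τ ∈ T, τ.IsSwap) {σ : Equiv.Perm (Fin n)} (hσ : σ ∈ Subgroup.closure T) (x : V) :
    ρ σ x - (((Equiv.Perm.sign σ : ℤˣ) : ℤ) : ℂ) • x ∈ sumFixed ρ T := by
  induction hσ using Subgroup.closure_induction generalizing x with
  | mem τ hτ =>
    have hinv : τ * τ = 1 := by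
      obtain ⟨a, b, -, rfl⟩ := hT τ hτ
      exact Equiv.swap_mul_self a b
    refine Submodule.mem_iSup_of_mem τ (Submodule.mem_iSup_of_mem hτ ?_)
    rw [LinearMap.mem_eqLocus, (hT τ hτ).sign_eq]
    have h : ρ τ (ρ τ x) = x := by
      rw [← Module.End.mul_apply, ← map_mul, hinv, map_one, Module.End.one_apply]
    simp [h, add_comm]
  | one => simp
  | mul σ τ _ _ hσ hτ =>
    have h1 := hσ (ρ τ x)
    have h2 := Submodule.smul_mem _ (((Equiv.Perm.sign σ : ℤˣ) : ℤ) : ℂ) (hτ x)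
    have h3 := Submodule.add_mem _ h1 h2
    convert h3 using 1
    rw [map_mul, map_mul, Module.End.mul_apply, smul_sub, smul_smul]
    push_cast
    abel
  | inv σ _ hσ =>
    have h1 := Submodule.smul_mem _ (-(((Equiv.Perm.sign σ : ℤˣ) : ℤ) : ℂ)) (hσ (ρ σ⁻¹ x))
    have h : ρ σ (ρ σ⁻¹ x) = x := by
      rw [← Module.End.mul_apply, ← map_mul, mul_inv_cancel, map_one, Module.End.one_apply]
    rw [h] at h1
    convert h1 using 1
    rw [Equiv.Perm.sign_inv, smul_sub, smul_smul]
    rcases Int.units_eq_one_or (Equiv.Perm.sign σ) with h | h <;> simp [h] <;> abel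

theorem sumFixed_eq_intrinsicHyperplane {n : ℕ} {V : Type*} [AddCommMonoid V] [Module ℂ V]
    (ρ : Representation ℂ (Equiv.Perm (Fin n)) V)
    (α : Finpartition (Finset.univ : Finset (Fin n))) {T : Set (Equiv.Perm (Fin n))}
    (hT : ∀ τ ∈ T, τ.IsSwap) (hcl : Subgroup.closure T = partSubgroup α) :
    sumFixed ρ T = intrinsicHyperplane ρ α := by
  let _ : AddCommGroup V := Module.addCommMonoidToAddCommGroup ℂ
  refine le_antisymm (biSup_mono fun τ hτ => ⟨hT τ hτ, hcl ▸ Subgroup.subset_closure hτ⟩) ?_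
  refine iSup₂_le fun τ hτ x hx => ?_
  have h := apply_sub_sign_smul_mem_sumFixed ρ hT (hcl ▸ hτ.2 : τ ∈ Subgroup.closure T) x
  rw [LinearMap.mem_eqLocus, LinearMap.id_apply] at hx
  rw [hx, hτ.1.sign_eq] at h
  -- For x fixed by τ the membership `h` reads 2x ∈ `sumFixed ρ T`.
  have h2 := Submodule.smul_mem _ (2⁻¹ : ℂ) h
  convert h2 using 1
  rw [← one_smul ℂ x, smul_smul, ← sub_smul, smul_smul]
  norm_num

/-! ### Self-duality -/

instance (lam : YoungDiagram) (n : ℕ) : FiniteDimensional ℂ (paddedSpecht lam n) := by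
  by_cases h : lam.card + lam.rowLen 0 ≤ n
  · rw [paddedSpecht, dif_pos h]
    exact FiniteDimensional.span_of_finite ℂ (Set.finite_range _)
  · rw [paddedSpecht, dif_neg h]
    infer_instance

/-- Coefficientwise complex conjugation. -/
def conjRow {n : ℕ} (x : RowSpace n) : RowSpace n :=
  Finsupp.mapRange (starRingEnd ℂ) (map_zero _) x

/-- The polytabloids have real coefficients, so conjugation fixes the spanning vectors. -/
theorem conjRow_mem {lam : YoungDiagram} {n : ℕ} {x : RowSpace n} (hx : x ∈ paddedSpecht lam n) :
    conjRow x ∈ paddedSpecht lam n := by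
  unfold paddedSpecht at *
  split_ifs at * with h
  · unfold specht at *
    induction hx using Submodule.span_induction with
    | mem x hx =>
      obtain ⟨T, rfl⟩ := hx
      refine Submodule.subset_span ⟨T, ?_⟩
      ext r
      simp only [polytabloid, conjRow, Finsupp.mapRange_apply, Finsupp.finsetSum_apply, map_sum]
      refine Finset.sum_congr rfl fun σ _ => ?_
      rw [Finsupp.single_apply]
      split_ifs <;> simp
    | zero => simp [conjRow]
    | add x y _ _ hx hy =>
      have : conjRow (x + y) = conjRow x + conjRow y := Finsupp.mapRange_add (map_add _) x y
      rw [this]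
      exact Submodule.add_mem _ hx hy
    | smul a x _ hx =>
      have : conjRow (a • x) = (starRingEnd ℂ a) • conjRow x := by
        ext r
        simp [conjRow]
      rw [this]
      exact Submodule.smul_mem _ _ hx
  · rw [Submodule.mem_bot] at *
    simp [hx, conjRow]

/-- The bilinear form on the Specht module for which the tabloids are orthonormal. -/
def tabloidForm (lam : YoungDiagram) (n : ℕ) :
    paddedSpecht lam n →ₗ[ℂ] Module.Dual ℂ (paddedSpecht lam n) :=
  (Finsupp.linearCombination ℂ fun r : Fin n → ℕ =>
    (Finsupp.lapply r ∘ₗ (paddedSpecht lam n).subtype : Module.Dual ℂ (paddedSpecht lam n))) ∘ₗ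
      (paddedSpecht lam n).subtype

theorem tabloidForm_apply {lam : YoungDiagram} {n : ℕ} (x y : paddedSpecht lam n) :
    tabloidForm lam n x y = x.1.sum fun r c => c * y.1 r := by
  simp [tabloidForm, Finsupp.linearCombination_apply, Finsupp.sum, LinearMap.sum_apply]

theorem tabloidForm_spechtRep {lam : YoungDiagram} {n : ℕ} (σ : Equiv.Perm (Fin n))
    (x y : paddedSpecht lam n) :
    tabloidForm lam n (spechtRep lam n σ x) y = tabloidForm lam n x (spechtRep lam n σ⁻¹ y) := by
  rw [tabloidForm_apply, tabloidForm_apply, coe_spechtRep, coe_spechtRep]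
  have h : rowMap σ.toEmbedding x.1 = Finsupp.mapDomain (fun r => r ∘ ⇑σ⁻¹) x.1 := by
    change Finsupp.mapDomain _ _ = _
    congr 1
    funext r a
    obtain ⟨b, rfl⟩ := σ.surjective a
    refine (σ.injective.extend_apply r (fun _ => 0) b).trans ?_
    simp
  rw [h, Finsupp.sum_mapDomain_index (by simp) fun _ _ _ => add_mul _ _ _]
  simp only [rowMap_perm_apply]

/-- Pairing x with its conjugate gives ∑ |x_r|², so the complex bilinear form is nondegenerate on
the Specht module. -/
theorem tabloidForm_injective (lam : YoungDiagram) (n : ℕ) :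
    Function.Injective (tabloidForm lam n) := by
  rw [injective_iff_map_eq_zero]
  intro x hx
  have h := LinearMap.congr_fun hx ⟨conjRow x.1, conjRow_mem x.2⟩
  rw [tabloidForm_apply, LinearMap.zero_apply] at h
  have h2 : ((∑ r ∈ x.1.support, Complex.normSq (x.1 r) : ℝ) : ℂ) = 0 := by
    rw [← h]
    simp [Finsupp.sum, conjRow, Complex.mul_conj]
  have h3 := (Finset.sum_eq_zero_iff_of_nonneg fun r _ => Complex.normSq_nonneg (x.1 r)).1
    (Complex.ofReal_eq_zero.1 h2)
  ext r
  by_contra hr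
  exact hr (Complex.normSq_eq_zero.1 (h3 r (Finsupp.mem_support_iff.2 hr)))

theorem surjective_dual_of_injective {V : Type*} [AddCommGroup V] [Module ℂ V]
    [FiniteDimensional ℂ V] (f : V →ₗ[ℂ] Module.Dual ℂ V) (hf : Function.Injective f) :
    Function.Surjective f :=
  (LinearMap.injective_iff_surjective_of_finrank_eq_finrank Subspace.dual_finrank_eq.symm).1 hf

theorem exists_isSelfDuality (lam : YoungDiagram) (n : ℕ) :
    ∃ e : paddedSpecht lam n ≃ₗ[ℂ] Module.Dual ℂ (paddedSpecht lam n), IsSelfDuality lam n e := by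
  have hinj := tabloidForm_injective lam n
  refine ⟨LinearEquiv.ofBijective (tabloidForm lam n)
    ⟨hinj, surjective_dual_of_injective (V := paddedSpecht lam n) (tabloidForm lam n) hinj⟩, fun σ x => ?_⟩
  ext1 y
  exact tabloidForm_spechtRep σ x y

/-! ### Orthogonal complements with respect to a self-duality -/

section Dual

variable {V W : Type*} [AddCommGroup V] [Module ℂ V] [AddCommGroup W] [Module ℂ W]

/-- The vectors orthogonal to `v` under the identification `e` of `V` with its dual. -/
def orthogonal (e : V ≃ₗ[ℂ] Module.Dual ℂ V) (v : V) : Submodule ℂ V :=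
  LinearMap.ker (e.toLinearMap.flip v)

theorem mem_orthogonal {e : V ≃ₗ[ℂ] Module.Dual ℂ V} {v x : V} :
    x ∈ orthogonal e v ↔ e x v = 0 := Iff.rfl

theorem eq_zero_of_forall_dual (e : V ≃ₗ[ℂ] Module.Dual ℂ V) {v : V} (hv : ∀ x, e x v = 0) :
    v = 0 := by
  refine (Module.forall_dual_apply_eq_zero_iff ℂ v).1 fun φ => ?_
  simpa using hv (e.symm φ)

theorem finrank_quotient_orthogonal (e : V ≃ₗ[ℂ] Module.Dual ℂ V) {v : V} (hv : v ≠ 0) :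
    Module.finrank ℂ (V ⧸ orthogonal e v) = 1 := by
  have hne : e.toLinearMap.flip v ≠ 0 := by
    intro h
    exact hv (eq_zero_of_forall_dual e fun x => LinearMap.congr_fun h x)
  change Module.finrank ℂ (V ⧸ LinearMap.ker (e.toLinearMap.flip v)) = 1
  rw [(LinearMap.quotKerEquivOfSurjective _ (LinearMap.surjective hne)).finrank_eq]
  exact Module.finrank_self ℂ

theorem finrank_quotient_eq_one_of_forall {V : ℕ → Type*} [∀ n, AddCommGroup (V n)]
    [∀ n, Module ℂ (V n)] {A : ∀ n, Set (Submodule ℂ (V n))}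
    (h : ∀ n, ∀ H ∈ A n, ∃ (e : V n ≃ₗ[ℂ] Module.Dual ℂ (V n)) (v : V n),
      v ≠ 0 ∧ H = orthogonal e v) :
    ∀ n, ∀ H ∈ A n, Module.finrank ℂ (V n ⧸ H) = 1 := by
  intro n H hH
  obtain ⟨e, v, hv, rfl⟩ := h n H hH
  exact finrank_quotient_orthogonal e hv

/-- A vector of v^⊥ outside H would be separated from H by a functional. By reflexivity this
functional is x ↦ e x w for some w, and w is then a multiple of v. -/
theorem eq_orthogonal [FiniteDimensional ℂ V] {e : V ≃ₗ[ℂ] Module.Dual ℂ V} {v : V}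
    {H : Submodule ℂ V} (hH : ∀ x ∈ H, e x v = 0)
    (huniq : ∀ w, (∀ x ∈ H, e x w = 0) → ∃ c : ℂ, w = c • v) : H = orthogonal e v := by
  refine le_antisymm hH fun x hx => ?_
  by_contra hxH
  obtain ⟨φ, hφx, hφ⟩ := Submodule.exists_le_ker_of_notMem hxH
  obtain ⟨w, hw⟩ := (Module.evalEquiv ℂ V).surjective (φ ∘ₗ e.symm.toLinearMap)
  have hφe : ∀ y, φ y = e y w := by
    intro y
    have := LinearMap.congr_fun hw (e y)
    simpa using this.symm
  obtain ⟨c, rfl⟩ := huniq w fun y hy => by rw [← hφe]; exact hφ hy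
  apply hφx
  rw [hφe, map_smul, mem_orthogonal.1 hx, smul_zero]

/-- A subspace is cut out by the functionals vanishing on it, and each of these is some e x. -/
theorem mem_range_of_forall_dual {e : V ≃ₗ[ℂ] Module.Dual ℂ V} {g : W →ₗ[ℂ] V} {v : V}
    (h : ∀ x, (∀ y, e x (g y) = 0) → e x v = 0) : v ∈ LinearMap.range g := by
  by_contra hv
  obtain ⟨φ, hφv, hφ⟩ := Submodule.exists_le_ker_of_notMem hv
  apply hφv
  have := h (e.symm φ) fun y => by simpa using hφ (LinearMap.mem_range_self g y)
  simpa using this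

theorem comap_orthogonal {e : V ≃ₗ[ℂ] Module.Dual ℂ V} {d : W ≃ₗ[ℂ] Module.Dual ℂ W}
    {g : W →ₗ[ℂ] V} {φ : V →ₗ[ℂ] W} (hφ : ∀ x y, d (φ x) y = e x (g y)) {w : W} {v : V} {c : ℂ}
    (hc : c ≠ 0) (hw : g w = c • v) : (orthogonal d w).comap φ = orthogonal e v := by
  ext x
  rw [Submodule.mem_comap, mem_orthogonal, mem_orthogonal, hφ, hw, map_smul, smul_eq_zero,
    or_iff_right hc]

end Dual

/-! ### The intrinsic arrangement in terms of polytabloids -/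

section Padded

variable {lam : YoungDiagram} {m n : ℕ}

theorem paddedSpecht_eq (h : lam.card + lam.rowLen 0 ≤ n) :
    paddedSpecht lam n = specht (padded lam n h) n := dif_pos h

/-- The vector `v_T`, as an element of `S^lam_n`. -/
def spechtVec (h : lam.card + lam.rowLen 0 ≤ n) (T : (padded lam n h).cells ≃ Fin n) :
    paddedSpecht lam n :=
  ⟨polytabloid T, (paddedSpecht_eq h).ge (Submodule.subset_span ⟨T, rfl⟩)⟩

theorem spechtVec_ne_zero (h : lam.card + lam.rowLen 0 ≤ n)
    (T : (padded lam n h).cells ≃ Fin n) : spechtVec h T ≠ 0 := fun h0 =>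
  polytabloid_ne_zero T (congrArg Subtype.val h0)

theorem exists_eq_smul_spechtVec (h : lam.card + lam.rowLen 0 ≤ n)
    (T : (padded lam n h).cells ≃ Fin n) {x : paddedSpecht lam n}
    (hx : ∀ τ ∈ columnStabilizer T, τ.IsSwap → spechtRep lam n τ x + x = 0) :
    ∃ c : ℂ, x = c • spechtVec h T :=
  ⟨_, Subtype.ext (eq_smul_polytabloid T ((paddedSpecht_eq h).le x.2) fun τ hτ hsw =>
    eq_neg_of_add_eq_zero_left (congrArg Subtype.val (hx τ hτ hsw)))⟩

theorem IsSelfDuality.apply_apply {e : paddedSpecht lam n ≃ₗ[ℂ] Module.Dual ℂ (paddedSpecht lam n)}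
    (he : IsSelfDuality lam n e) (σ : Equiv.Perm (Fin n)) (x y : paddedSpecht lam n) :
    e (spechtRep lam n σ x) y = e x (spechtRep lam n σ⁻¹ y) := by
  rw [he, Representation.dual_apply]
  rfl

theorem swap_inv {τ : Equiv.Perm (Fin n)} (hτ : τ.IsSwap) : τ⁻¹ = τ := by
  obtain ⟨a, b, -, rfl⟩ := hτ
  exact Equiv.swap_inv a b

theorem spechtRep_swap_swap {τ : Equiv.Perm (Fin n)} (hτ : τ.IsSwap) (x : paddedSpecht lam n) :
    spechtRep lam n τ (spechtRep lam n τ x) = x := by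
  have h : τ * τ = 1 := by
    obtain ⟨a, b, -, rfl⟩ := hτ
    exact Equiv.swap_mul_self a b
  rw [← Module.End.mul_apply, ← map_mul, h, map_one, Module.End.one_apply]

theorem intrinsicHyperplane_eq_orthogonal
    {e : paddedSpecht lam n ≃ₗ[ℂ] Module.Dual ℂ (paddedSpecht lam n)}
    (he : IsSelfDuality lam n e) (h : lam.card + lam.rowLen 0 ≤ n)
    {T : (padded lam n h).cells ≃ Fin n} {α : Finpartition (Finset.univ : Finset (Fin n))}
    (hα : IsColumnPartition T α) :
    intrinsicHyperplane (spechtRep lam n) α = orthogonal e (spechtVec h T) := by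
  have hmem : ∀ τ, τ ∈ partSubgroup α ↔ τ ∈ columnStabilizer T := fun τ => by
    rw [mem_columnStabilizer]
    exact forall_congr' fun a => hα _ _
  refine eq_orthogonal (V := paddedSpecht lam n) ?_ ?_
  · suffices hle : intrinsicHyperplane (spechtRep lam n) α ≤ orthogonal e (spechtVec h T) from
      fun x hx => hle hx
    refine iSup₂_le fun τ hτ x hx => ?_
    rw [LinearMap.mem_eqLocus, LinearMap.id_apply] at hx
    have hv : spechtRep lam n τ (spechtVec h T) + spechtVec h T = 0 := by
      apply Subtype.ext
      change rowMap τ.toEmbedding (polytabloid T) + polytabloid T = 0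
      rw [rowMap_perm_polytabloid T ((hmem τ).1 hτ.2), hτ.1.sign_eq]
      simp
    have h1 := he.apply_apply τ x (spechtVec h T)
    have h2 := congrArg (e x) hv
    rw [hx, swap_inv hτ.1] at h1
    rw [map_add, ← h1, map_zero] at h2
    exact mem_orthogonal.2 (self_eq_neg.1 (eq_neg_of_add_eq_zero_left h2))
  · intro w hw
    refine exists_eq_smul_spechtVec h T fun τ hτ hsw => ?_
    refine eq_zero_of_forall_dual (V := paddedSpecht lam n) e fun y => ?_
    -- Pairing y + τy ∈ V^τ with w, and moving τ across by equivariance, shows that τw + w pairs to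
    -- zero with every y.
    have hy : y + spechtRep lam n τ y ∈ intrinsicHyperplane (spechtRep lam n) α := by
      refine Submodule.mem_iSup_of_mem τ (Submodule.mem_iSup_of_mem ⟨hsw, (hmem τ).2 hτ⟩ ?_)
      rw [LinearMap.mem_eqLocus, map_add, spechtRep_swap_swap hsw, add_comm]
      rfl
    have h1 := hw _ hy
    rw [map_add, LinearMap.add_apply, he.apply_apply, swap_inv hsw] at h1
    rw [map_add, add_comm, h1]

theorem mem_intrinsicArrangement_iff
    {e : paddedSpecht lam n ≃ₗ[ℂ] Module.Dual ℂ (paddedSpecht lam n)}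
    (he : IsSelfDuality lam n e) {H : Submodule ℂ (paddedSpecht lam n)} :
    H ∈ intrinsicArrangement lam n ↔ ∃ (h : lam.card + lam.rowLen 0 ≤ n)
      (T : (padded lam n h).cells ≃ Fin n), H = orthogonal e (spechtVec h T) := by
  constructor
  · rintro ⟨h, α, hα, rfl⟩
    obtain ⟨T, hT⟩ := exists_tableau_of_hasShape hα
    exact ⟨h, T, intrinsicHyperplane_eq_orthogonal he h hT⟩
  · rintro ⟨h, T, rfl⟩
    obtain ⟨α, hα, hT⟩ := exists_isColumnPartition T
    exact ⟨h, α, hα, (intrinsicHyperplane_eq_orthogonal he h hT).symm⟩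

/-! ### Polytabloids in the image of f_* -/

theorem exists_spechtMap_spechtVec (f : Fin m ↪ Fin n) (hm : lam.card + lam.rowLen 0 ≤ m)
    (hn : lam.card + lam.rowLen 0 ≤ n) (T : (padded lam m hm).cells ≃ Fin m) :
    ∃ T' : (padded lam n hn).cells ≃ Fin n,
      spechtMap lam f (spechtVec hm T) = spechtVec hn T' := by
  obtain ⟨T', hT'⟩ := rowMap_polytabloid f hm hn T
  exact ⟨T', Subtype.ext hT'⟩

theorem mem_cells_padded_zero {h : lam.card + lam.rowLen 0 ≤ n} {c : ℕ × ℕ}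
    (hc : c ∈ (padded lam n h).cells) (hcol : lam.rowLen 0 ≤ c.2) :
    c.1 = 0 ∧ c.2 < n - lam.card := by
  rcases mem_padded.1 hc with h0 | ⟨i, -, hi⟩
  · exact h0
  · have h1 := YoungDiagram.mem_iff_lt_rowLen.1 (lam.up_left_mem (Nat.zero_le _) le_rfl hi)
    omega

/-- The first λ_1 columns of λ[n] do not depend on n, because the first row always has at least λ_1
cells. -/
theorem mem_cells_padded_of_lt {hm : lam.card + lam.rowLen 0 ≤ m}
    {hn : lam.card + lam.rowLen 0 ≤ n} {c : ℕ × ℕ} (hc : c ∈ (padded lam n hn).cells)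
    (hcol : c.2 < lam.rowLen 0) : c ∈ (padded lam m hm).cells := by
  rw [mem_padded] at hc ⊢
  exact hc.imp (fun h => ⟨h.1, by omega⟩) id

/-- If the entries of `T` outside the image of `f` lie in columns of length one beyond `lam_1`,
then `v_T` is, up to a scalar, the image of some `v_{T₀}` under `f_*`. -/
theorem exists_spechtMap_eq_smul (f : Fin m ↪ Fin n) (hm : lam.card + lam.rowLen 0 ≤ m)
    (hn : lam.card + lam.rowLen 0 ≤ n) (T : (padded lam n hn).cells ≃ Fin n)
    (hf : ∀ b, (¬ ∃ a, f a = b) → lam.rowLen 0 ≤ (T.symm b).1.2) :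
    ∃ (T₀ : (padded lam m hm).cells ≃ Fin m) (c : ℂ), c ≠ 0 ∧
      spechtMap lam f (spechtVec hm T₀) = c • spechtVec hn T := by
  -- T₀ (the inverse of `g`) copies T on the first λ_1 columns, all of whose entries lie in the
  -- image of f, and is arbitrary elsewhere.
  obtain ⟨g, hg⟩ := Finset.exists_equiv_extend_of_card_eq (α := Fin m)
    (t := (padded lam m hm).cells) (by rw [card_padded, Fintype.card_fin])
    (s := Finset.univ.filter fun a => (T.symm (f a)).1.2 < lam.rowLen 0)
    (f := fun a => (T.symm (f a)).1)
    (by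
      intro c hc
      obtain ⟨a, ha, rfl⟩ := Finset.mem_image.1 hc
      exact mem_cells_padded_of_lt (T.symm (f a)).2 (Finset.mem_filter.1 ha).2)
    (fun a _ b _ hab => f.injective (T.symm.injective (Subtype.ext hab)))
  have hcol : ∀ a, (T.symm (f a)).1.2 < lam.rowLen 0 → (g a).1 = (T.symm (f a)).1 := fun a ha =>
    hg a (Finset.mem_filter.2 ⟨Finset.mem_univ a, ha⟩)
  obtain ⟨T', hT'⟩ := exists_spechtMap_spechtVec f hm hn g.symm
  have hne : spechtMap lam f (spechtVec hm g.symm) ≠ 0 := hT' ▸ spechtVec_ne_zero hn T'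
  -- A transposition in C(T) moves entries of the first λ_1 columns only, so it comes from one in
  -- C(T₀), which negates v_{T₀}. One-dimensionality then yields the scalar c.
  have hsgn : ∀ τ ∈ columnStabilizer T, τ.IsSwap →
      spechtRep lam n τ (spechtMap lam f (spechtVec hm g.symm)) +
        spechtMap lam f (spechtVec hm g.symm) = 0 := by
    rintro τ hτ ⟨b, b', hbb, rfl⟩
    have hc : (T.symm b').1.2 = (T.symm b).1.2 := by
      have := (mem_columnStabilizer T).1 hτ b
      rwa [Equiv.swap_apply_left] at this
    have hlt : (T.symm b).1.2 < lam.rowLen 0 := by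
      by_contra hge
      push Not at hge
      refine hbb (T.symm.injective (Subtype.ext (Prod.ext ?_ hc.symm)))
      rw [(mem_cells_padded_zero (T.symm b).2 hge).1,
        (mem_cells_padded_zero (T.symm b').2 (hc ▸ hge)).1]
    have hex : ∀ b, (T.symm b).1.2 < lam.rowLen 0 → ∃ a, f a = b := fun b hb => by
      by_contra h
      exact absurd (hf b h) (not_le.2 hb)
    obtain ⟨a, rfl⟩ := hex b hlt
    obtain ⟨a', rfl⟩ := hex b' (hc ▸ hlt)
    have haa : a ≠ a' := fun h => hbb (congrArg f h)
    have hmem : Equiv.swap a a' ∈ columnStabilizer g.symm := by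
      refine swap_mem_columnStabilizer _ ?_
      rw [Equiv.symm_symm, hcol a hlt, hcol a' (hc ▸ hlt), hc]
    have htr : f.trans (Equiv.swap (f a) (f a')).toEmbedding =
        (Equiv.swap a a').toEmbedding.trans f := by
      ext1 b
      exact (f.injective.swap_apply a a' b).symm ▸ rfl
    apply Subtype.ext
    change rowMap _ (rowMap f (polytabloid g.symm)) + rowMap f (polytabloid g.symm) = 0
    rw [← LinearMap.comp_apply, ← rowMap_trans, htr, rowMap_trans, LinearMap.comp_apply,
      rowMap_perm_polytabloid _ hmem, Equiv.Perm.sign_swap haa]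
    simp
  obtain ⟨c, hc⟩ := exists_eq_smul_spechtVec hn T hsgn
  exact ⟨g.symm, c, fun h0 => hne (by rw [hc, h0, zero_smul]), hc⟩

/-- If `v_T` lies in the image of `f_*`, then the entries of `T` outside the image of `f` lie in
columns beyond `lam_1`. -/
theorem rowLen_le_of_mem_range (f : Fin m ↪ Fin n) (hn : lam.card + lam.rowLen 0 ≤ n)
    (T : (padded lam n hn).cells ≃ Fin n)
    (hT : spechtVec hn T ∈ LinearMap.range (spechtMap lam f)) {b : Fin n} (hb : ¬ ∃ a, f a = b) :
    lam.rowLen 0 ≤ (T.symm b).1.2 := by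
  by_contra hlt
  push Not at hlt
  obtain ⟨x, hx⟩ := hT
  -- The column of b has a cell in row 1, with entry d. Swapping b and d puts b into row 1 of a
  -- tabloid with coefficient ±1 in v_T, whereas vectors in the image of f_* involve only tabloids
  -- with b in row 0. The case b = d is included.
  have hcell : (1, (T.symm b).1.2) ∈ (padded lam n hn).cells :=
    mem_padded.2 (Or.inr ⟨0, rfl, YoungDiagram.mem_iff_lt_rowLen.2 hlt⟩)
  set d := T ⟨_, hcell⟩ with hd
  have hdT : (T.symm d).1 = (1, (T.symm b).1.2) := by rw [hd, Equiv.symm_apply_apply]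
  have hσ : Equiv.swap b d ∈ columnStabilizer T := swap_mem_columnStabilizer T (by rw [hdT])
  have h1 := polytabloid_apply_tabloid T hσ
  have hrow : tabloid (T.trans (Equiv.swap b d)) b ≠ 0 := by
    rw [tabloid_trans, Equiv.swap_inv, Function.comp_apply, Equiv.swap_apply_left, tabloid, hdT]
    exact one_ne_zero
  have h2 := rowMap_apply_eq_zero f x.1 hb hrow
  have h3 : rowMap f x.1 = polytabloid T := congrArg Subtype.val hx
  rw [h3, h1] at h2
  rcases Int.units_eq_one_or (Equiv.Perm.sign (Equiv.swap b d)) with h | h <;> simp [h] at h2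

/-- The entries of the columns up to `lam_1` of a tableau of shape `lam[n]` form the image of an
injection. -/
theorem exists_embedding_columns (hn : lam.card + lam.rowLen 0 ≤ n)
    (T : (padded lam n hn).cells ≃ Fin n) :
    ∃ f : Fin (lam.card + lam.rowLen 0) ↪ Fin n,
      ∀ b, (¬ ∃ a, f a = b) → lam.rowLen 0 ≤ (T.symm b).1.2 := by
  have hsub : (padded lam _ (le_refl (lam.card + lam.rowLen 0))).cells ⊆
      (padded lam n hn).cells := fun c hc => by
    rw [mem_padded] at hc ⊢
    exact hc.imp (fun h => ⟨h.1, by omega⟩) id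
  -- For n = |λ| + λ_1 the first row has exactly λ_1 cells, so this diagram consists of the first
  -- λ_1 columns of λ[n].
  let i := (Finset.equivFinOfCardEq (card_padded lam _ (le_refl (lam.card + lam.rowLen 0)))).symm
  refine ⟨i.toEmbedding.trans ((Subtype.impEmbedding _ _ hsub).trans T.toEmbedding),
    fun b hb => ?_⟩
  by_contra hlt
  push Not at hlt
  refine hb ⟨i.symm ⟨_, mem_cells_padded_of_lt (T.symm b).2 hlt⟩, ?_⟩
  rw [Function.Embedding.trans_apply, Equiv.coe_toEmbedding, Equiv.apply_symm_apply]
  exact (congrArg T (Subtype.ext rfl)).trans (T.apply_symm_apply b)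

end Padded

/-! ### The FI-arrangement -/

section Arrangement

variable {lam : YoungDiagram}
  {e : ∀ n, paddedSpecht lam n ≃ₗ[ℂ] Module.Dual ℂ (paddedSpecht lam n)}

theorem dualSpechtMap_apply {m n : ℕ} (f : Fin m ↪ Fin n) (x : paddedSpecht lam n)
    (y : paddedSpecht lam m) :
    e m (dualSpechtMap lam e m n f x) y = e n x (spechtMap lam f y) := by
  simp [dualSpechtMap]

theorem finite_intrinsicArrangement {n : ℕ} (he : IsSelfDuality lam n (e n)) :
    (intrinsicArrangement lam n).Finite := by
  by_cases h : lam.card + lam.rowLen 0 ≤ n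
  · refine (Set.finite_range fun T : (padded lam n h).cells ≃ Fin n =>
      orthogonal (e n) (spechtVec h T)).subset fun H hH => ?_
    obtain ⟨_, T, rfl⟩ := (mem_intrinsicArrangement_iff he).1 hH
    exact ⟨T, rfl⟩
  · exact Set.finite_empty.subset fun H hH => h hH.1

theorem dualSpechtMap_refl (n : ℕ) :
    dualSpechtMap lam e n n (Function.Embedding.refl (Fin n)) = LinearMap.id := by
  ext1 x
  refine (e n).injective (LinearMap.ext fun y => ?_)
  rw [dualSpechtMap_apply, spechtMap_refl]
  rfl

theorem dualSpechtMap_trans {l m n : ℕ} (f : Fin l ↪ Fin m) (g : Fin m ↪ Fin n) :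
    dualSpechtMap lam e l n (f.trans g) =
      dualSpechtMap lam e l m f ∘ₗ dualSpechtMap lam e m n g := by
  ext1 x
  refine (e l).injective (LinearMap.ext fun y => ?_)
  rw [LinearMap.comp_apply, dualSpechtMap_apply, dualSpechtMap_apply, dualSpechtMap_apply,
    spechtMap_trans, LinearMap.comp_apply]

theorem dualSpechtMap_surjective {m n : ℕ} (f : Fin m ↪ Fin n) :
    Function.Surjective (dualSpechtMap lam e m n f) := by
  have h := (LinearMap.dualMap_surjective_iff (V₁ := paddedSpecht lam m)
    (V₂ := paddedSpecht lam n) (f := spechtMap lam f)).2 (spechtMap_injective lam f)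
  exact (e m).symm.surjective.comp (h.comp (e n).surjective)

theorem comap_mem_intrinsicArrangement (he : ∀ n, IsSelfDuality lam n (e n)) {m n : ℕ}
    (f : Fin m ↪ Fin n) {H : Submodule ℂ (paddedSpecht lam m)}
    (hH : H ∈ intrinsicArrangement lam m) :
    H.comap (dualSpechtMap lam e m n f) ∈ intrinsicArrangement lam n := by
  obtain ⟨hm, T, rfl⟩ := (mem_intrinsicArrangement_iff (he m)).1 hH
  have hmn : m ≤ n := by simpa using Fintype.card_le_of_embedding f
  obtain ⟨T', hT'⟩ := exists_spechtMap_spechtVec f hm (hm.trans hmn) T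
  refine (mem_intrinsicArrangement_iff (he n)).2 ⟨hm.trans hmn, T', ?_⟩
  exact comap_orthogonal (V := paddedSpecht lam n) (W := paddedSpecht lam m)
    (dualSpechtMap_apply f) one_ne_zero (by rw [hT', one_smul])

theorem isFIArrangement (he : ∀ n, IsSelfDuality lam n (e n)) :
    IsFIArrangement (V := fun n => paddedSpecht lam n) (intrinsicArrangement lam)
      (dualSpechtMap lam e) where
  finiteDimensional n := inferInstanceAs (FiniteDimensional ℂ (paddedSpecht lam n))
  finite n := finite_intrinsicArrangement (he n)
  isHyperplane := finrank_quotient_eq_one_of_forall fun n H hH => by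
    obtain ⟨h, T, hT⟩ := (mem_intrinsicArrangement_iff (he n)).1 hH
    exact ⟨e n, spechtVec h T, spechtVec_ne_zero h T, hT⟩
  map_refl := dualSpechtMap_refl
  map_trans _ _ _ f g := dualSpechtMap_trans f g
  surjective _ _ f := dualSpechtMap_surjective f
  comap_mem _ _ f _ hH := comap_mem_intrinsicArrangement he f hH

theorem exists_comap_eq (he : ∀ n, IsSelfDuality lam n (e n)) {m n : ℕ} (f : Fin m ↪ Fin n)
    (hm : lam.card + lam.rowLen 0 ≤ m) (hn : lam.card + lam.rowLen 0 ≤ n)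
    (T : (padded lam n hn).cells ≃ Fin n)
    (hf : ∀ b, (¬ ∃ a, f a = b) → lam.rowLen 0 ≤ (T.symm b).1.2) :
    ∃ U ∈ intrinsicArrangement lam m,
      orthogonal (e n) (spechtVec hn T) = U.comap (dualSpechtMap lam e m n f) := by
  obtain ⟨T₀, c, hc, hT₀⟩ := exists_spechtMap_eq_smul f hm hn T hf
  exact ⟨_, (mem_intrinsicArrangement_iff (he m)).2 ⟨hm, T₀, rfl⟩,
    (comap_orthogonal (V := paddedSpecht lam n) (W := paddedSpecht lam m)
      (dualSpechtMap_apply f) hc hT₀).symm⟩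

theorem isFinitelyGenerated (he : ∀ n, IsSelfDuality lam n (e n)) :
    IsFinitelyGenerated (V := fun n => paddedSpecht lam n) (intrinsicArrangement lam)
      (dualSpechtMap lam e) := by
  refine ⟨lam.card + lam.rowLen 0, fun n hn S hS => ?_⟩
  obtain ⟨B, hB, rfl⟩ := hS
  -- Each hyperplane in `B` is itself pulled back from level N, so `B` serves as the family of
  -- preimages.
  refine ⟨B, fun H hH => ?_, rfl⟩
  obtain ⟨_, T, rfl⟩ := (mem_intrinsicArrangement_iff (he n)).1 (hB hH)
  obtain ⟨f, hf⟩ := exists_embedding_columns hn T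
  obtain ⟨U, hU, h⟩ := exists_comap_eq he f le_rfl hn T hf
  exact ⟨f, U, ⟨{U}, Set.singleton_subset_iff.2 hU, sInf_singleton.symm⟩, h⟩

theorem isNormal (he : ∀ n, IsSelfDuality lam n (e n)) :
    IsNormal (V := fun n => paddedSpecht lam n) (intrinsicArrangement lam)
      (dualSpechtMap lam e) := by
  intro m n f S hS hker
  obtain ⟨B, hB, rfl⟩ := hS
  have key : ∀ H ∈ B, ∃ U ∈ intrinsicArrangement lam m,
      H = U.comap (dualSpechtMap lam e m n f) := by
    intro H hH
    obtain ⟨hn, T, rfl⟩ := (mem_intrinsicArrangement_iff (he n)).1 (hB hH)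
    -- A functional e x vanishing on the image of f_* has x ∈ ker f^* ⊆ v_T^⊥, hence it also
    -- vanishes at v_T.
    have hmem : spechtVec hn T ∈ LinearMap.range (spechtMap lam f) := by
      refine mem_range_of_forall_dual (V := paddedSpecht lam n) (W := paddedSpecht lam m)
        (e := e n) fun x hx => ?_
      have hxker : x ∈ LinearMap.ker (dualSpechtMap lam e m n f) := by
        rw [LinearMap.mem_ker]
        refine (e m).injective (LinearMap.ext fun y => ?_)
        rw [dualSpechtMap_apply, hx, map_zero, LinearMap.zero_apply]
      exact (hker.trans (sInf_le hH)) hxker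
    -- Below the threshold S^λ_m = 0, and the nonzero v_T could not lie in the image.
    have hm : lam.card + lam.rowLen 0 ≤ m := by
      by_contra hm
      obtain ⟨⟨x, hx⟩, hxT⟩ := hmem
      rw [paddedSpecht, dif_neg hm, Submodule.mem_bot] at hx
      subst hx
      exact spechtVec_ne_zero hn T (hxT.symm.trans (map_zero _))
    exact exists_comap_eq he f hm hn T fun b hb => rowLen_le_of_mem_range f hn T hmem hb
  -- All hyperplanes of level m whose preimage belongs to `B` are intersected; for empty `B` this is
  -- the whole space, as needed.
  refine ⟨sInf {U ∈ intrinsicArrangement lam m | U.comap (dualSpechtMap lam e m n f) ∈ B},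
    ⟨_, fun U hU => hU.1, rfl⟩, ?_⟩
  ext x
  simp only [Submodule.mem_comap, Submodule.mem_sInf]
  constructor
  · intro hx U hU
    exact hx _ hU.2
  · intro hx H hH
    obtain ⟨U, hU, rfl⟩ := key H hH
    exact hx U ⟨hU, hH⟩

end Arrangement

end SpechtArr

end

theorem mainTheorem4 (lam : YoungDiagram) :
    -- the hyperplanes `H_α` do not depend on the chosen generating transpositions
    (∀ (n : ℕ) (h : lam.card + lam.rowLen 0 ≤ n)
      (α : Finpartition (Finset.univ : Finset (Fin n))),
      SpechtArr.HasShape α (SpechtArr.padded lam n h).transpose →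
      ∀ T : Set (Equiv.Perm (Fin n)), (∀ τ ∈ T, τ.IsSwap) →
        Subgroup.closure T = SpechtArr.partSubgroup α →
        SpechtArr.sumFixed (SpechtArr.spechtRep lam n) T =
          SpechtArr.intrinsicHyperplane (SpechtArr.spechtRep lam n) α) ∧
    -- the representations are self-dual
    (∀ n : ℕ, ∃ e : SpechtArr.paddedSpecht lam n ≃ₗ[ℂ] Module.Dual ℂ (SpechtArr.paddedSpecht lam n),
      SpechtArr.IsSelfDuality lam n e) ∧
    -- the dual FI-module makes the intrinsic arrangements a finitely generated normal FI-arrangement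
    (∀ e : ∀ n : ℕ, SpechtArr.paddedSpecht lam n ≃ₗ[ℂ]
        Module.Dual ℂ (SpechtArr.paddedSpecht lam n),
      (∀ n, SpechtArr.IsSelfDuality lam n (e n)) →
      SpechtArr.IsFIArrangement (V := fun n => SpechtArr.paddedSpecht lam n)
          (SpechtArr.intrinsicArrangement lam)
          (SpechtArr.dualSpechtMap lam e) ∧
        SpechtArr.IsFinitelyGenerated (V := fun n => SpechtArr.paddedSpecht lam n)
          (SpechtArr.intrinsicArrangement lam)
          (SpechtArr.dualSpechtMap lam e) ∧
        SpechtArr.IsNormal (V := fun n => SpechtArr.paddedSpecht lam n)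
          (SpechtArr.intrinsicArrangement lam)
          (SpechtArr.dualSpechtMap lam e)) := by
  exact ⟨fun n _ α _ _ hT hcl =>
      SpechtArr.sumFixed_eq_intrinsicHyperplane (V := SpechtArr.paddedSpecht lam n)
        (SpechtArr.spechtRep lam n) α hT hcl,
    SpechtArr.exists_isSelfDuality lam, fun _ he => ⟨SpechtArr.isFIArrangement he,
      SpechtArr.isFinitelyGenerated he, SpechtArr.isNormal he⟩⟩
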